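/- Let $E$ be the set of undirected nearest neighbour edges of $\mathbb Z^2$ and let $\{t_e : e\in E\}$ be i.i.d. nonnegative random variables on a probability space $(\Omega,\mathcal F,P)$ with $E[e^{c_0t_e}]<\infty$ for some $c_0>0$. The value of a finite nearest neighbour path $\gamma$ is $V(\gamma)=\sum_{e\in\gamma}t_e$ (edges counted with multiplicity). Let $a_n$ be the infimum of $V(\gamma)$ over all paths $\gamma$ from $(0,0)$ to $(n,0)$, and let $\nu\ge 0$ be the nonrandom constant with $\lim_{n\to\infty}a_n/n=\nu$ almost surely. For integers $n,l\ge1$, a real $\delta\in(0,1/2)$ and integers $0\le k\le 2\delta n/l$, set $$A_k=[-\delta n+kl,\,-\delta n+(k+1)l]\cap\mathbb Z .$$ For $\varepsilon>0$, call the channel $A_k$ *good* if for all $x\in A_k\times\{\lfloor\delta n\rfloor\}$ and $y\in A_k\times\{\lfloor(1-\delta)n\rfloor\}$ there is a path $\gamma$ from $x$ to $y$, all of whose vertices lie in $A_k\times\mathbb Z$, with $V(\gamma)\le(\nu+\varepsilon/5)(1-2\delta)n$. Let $$\tilde G_{\delta n,n}=\Big\{\,\big|\{k:0\le k\le 2\delta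 n/l,\ A_k\text{ is good}\}\big|\ge\tfrac9{10}\cdot\tfrac{2\delta n}{l}\Big\}.$$ **Proposition 2.2.** There are $\varepsilon_0>0$ and $\delta_0>0$ such that for every $\varepsilon\in(0,\varepsilon_0)$ there is an integer $l_0\ge1$ with the following property: for every integer $l\ge l_0$ and every $\delta\in(0,\delta_0)$ there are $c>0$ and $n_0$ such that for all $n\ge n_0$ $$P(\tilde G_{\delta n,n})\ge 1-e^{-cn^2}.$$ -/

import Mathlib

open MeasureTheory ProbabilityTheory Filter Topology

noncomputable section

namespace FPP

/-- The nearest neighbour graph on `ℤ²`: `x ∼ y` iff `|x - y|₁ = 1`. -/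
def latticeGraph : SimpleGraph (ℤ × ℤ) where
  Adj x y := |x.1 - y.1| + |x.2 - y.2| = 1
  symm := ⟨fun x y h => by rwa [abs_sub_comm y.1 x.1, abs_sub_comm y.2 x.2]⟩
  loopless := ⟨fun x h => by simp at h⟩

/-- The set `E` of undirected nearest neighbour edges of `ℤ²`. -/
abbrev Edge : Type := latticeGraph.edgeSet

/-- The value (passage time) `V(γ) = ∑_{e ∈ γ} w_e` of a finite nearest neighbour path `γ`; an edge
that is crossed several times is counted each time. -/
def passageTime (w : Edge → ℝ) : {x y : ℤ × ℤ} → latticeGraph.Walk x y → ℝ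
  | _, _, .nil => 0
  | _, _, .cons (u := u) (v := v) h p =>
      w ⟨s(u, v), latticeGraph.mem_edgeSet.2 h⟩ + passageTime w p

/-- `a_n = inf V(γ)` over all finite nearest neighbour paths `γ` from `(0,0)` to `(n,0)`. -/
def pointToPoint (w : Edge → ℝ) (n : ℕ) : ℝ :=
  ⨅ γ : latticeGraph.Walk ((0 : ℤ), (0 : ℤ)) ((n : ℤ), (0 : ℤ)), passageTime w γ

/-- The time constant `ν`, that is, the almost sure value of `lim a_n / n`. To have a number that is
defined without knowing beforehand that the limit exists and is nonrandom, it is written as the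
essential supremum of `limsup a_n / n`; see `timeConstant_eq` below. -/
def timeConstant {Ω : Type*} [MeasurableSpace Ω] (P : Measure Ω) (t : Edge → Ω → ℝ) : ℝ :=
  essSup (fun ω => limsup (fun n : ℕ => pointToPoint (fun e => t e ω) n / n) atTop) P

/-- If `a_n / n` converges almost surely to a nonrandom `ν`, then `ν` is the time constant. -/
theorem timeConstant_eq {Ω : Type*} [MeasurableSpace Ω] (P : Measure Ω) [IsProbabilityMeasure P]
    (t : Edge → Ω → ℝ) (ν : ℝ)
    (h : ∀ᵐ ω ∂P, Tendsto (fun n : ℕ => pointToPoint (fun e => t e ω) n / n) atTop (𝓝 ν)) :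
    timeConstant P t = ν := by
  have h' : (fun ω => limsup (fun n : ℕ => pointToPoint (fun e => t e ω) n / n) atTop)
      =ᵐ[P] fun _ => ν := h.mono fun ω hω => hω.limsup_eq
  rw [timeConstant, essSup_congr_ae h', essSup_const _ (IsProbabilityMeasure.ne_zero P)]

/-- The base `A_k = [-δn + kl, -δn + (k+1)l]` (a set of lattice points) of the `k`th channel. -/
def channelBase (δ : ℝ) (n l k : ℕ) : Set ℤ :=
  {z : ℤ | -(δ * n) + k * l ≤ (z : ℝ) ∧ (z : ℝ) ≤ -(δ * n) + (k + 1) * l}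

/-- The `k`th channel is good (for the weights `w` and the constant `ν`): every entry point
`(a, ⌊δn⌋)` and every exit point `(b, ⌊(1-δ)n⌋)` with `a, b ∈ A_k` are joined by a path that stays
in `A_k × ℤ` and has value at most `(ν + ε/5)(1-2δ)n`. -/
def GoodChannel (w : Edge → ℝ) (ν ε δ : ℝ) (n l k : ℕ) : Prop :=
  ∀ a ∈ channelBase δ n l k, ∀ b ∈ channelBase δ n l k,
    ∃ γ : latticeGraph.Walk (a, ⌊δ * n⌋) (b, ⌊(1 - δ) * n⌋),
      (∀ v ∈ γ.support, v.1 ∈ channelBase δ n l k) ∧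
      passageTime w γ ≤ (ν + ε / 5) * (1 - 2 * δ) * n

/-- Among the channels `k = 0, 1, …, ⌊2δn/l⌋`, at least `(9/10)(2δn/l)` are good. -/
def MostChannelsGood (w : Edge → ℝ) (ν ε δ : ℝ) (n l : ℕ) : Prop :=
  9 / 10 * (2 * δ * n / l) ≤
    (({k : ℕ | (k : ℝ) ≤ 2 * δ * n / l ∧ GoodChannel w ν ε δ n l k}.ncard : ℕ) : ℝ)

end FPP

end

/-!
By Fatou's reverse lemma and the strong law for the straight path, `E[a_N] / N` is eventually below
any `τ > ν`. The infimum over all paths is a decreasing limit of infima over paths in large squares,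
so for a suitable `N` the restriction to a square does not spoil this bound. Placing many rotated
copies of such crossings on top of each other gives a box of height `L` whose expected crossing time
is less than `τ L`, and hence a small `θ > 0` for which the crossing time has exponential moment at
most `exp (θ τ L)`.

A channel that is wider than the box contains a tower of disjoint translates of it, whose crossing
times are independent, and boundedly many further edges join the tower to the entry and exit points.
With `τ = ν + ε / 10`, Chernoff's bound shows that a channel is bad with probability at most
`exp (-(α n - β))`. Disjoint channels are independent and their number is proportional to `n`, so a
tenth of them is bad with probability at most `exp (-c n²)`.
-/

open scoped ENNReal

namespace FPP

instance : Countable Edge := inferInstanceAs (Countable latticeGraph.edgeSet)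

instance {x y : ℤ × ℤ} : Countable (latticeGraph.Walk x y) :=
  Function.Injective.countable (f := fun γ => γ.support)
    fun _ _ h => SimpleGraph.Walk.ext_support h

section PassageTime

variable {w w' : Edge → ℝ}

lemma passageTime_nonneg (hw : ∀ e, 0 ≤ w e) : ∀ {x y : ℤ × ℤ} (γ : latticeGraph.Walk x y),
    0 ≤ passageTime w γ
  | _, _, .nil => le_rfl
  | _, _, .cons _ p => add_nonneg (hw _) (passageTime_nonneg hw p)

lemma passageTime_append : ∀ {x y z : ℤ × ℤ} (γ : latticeGraph.Walk x y)
    (γ' : latticeGraph.Walk y z),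
    passageTime w (γ.append γ') = passageTime w γ + passageTime w γ'
  | _, _, _, .nil, γ' => by simp [passageTime]
  | _, _, _, .cons _ p, γ' => by simp [passageTime, passageTime_append p γ', add_assoc]

lemma passageTime_reverse : ∀ {x y : ℤ × ℤ} (γ : latticeGraph.Walk x y),
    passageTime w γ.reverse = passageTime w γ
  | _, _, .nil => rfl
  | _, _, .cons h p => by
    simp only [SimpleGraph.Walk.reverse_cons, passageTime_append, passageTime_reverse p,
      passageTime, add_zero]
    rw [add_comm]
    congr 2
    exact Subtype.ext Sym2.eq_swap

lemma passageTime_map (w : Edge → ℝ) (φ : latticeGraph ≃g latticeGraph) :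
    ∀ {x y : ℤ × ℤ} (γ : latticeGraph.Walk x y),
    passageTime w (γ.map φ.toHom) = passageTime (w ∘ φ.mapEdgeSet) γ
  | _, _, .nil => rfl
  | _, _, .cons _ p => by
    simp only [SimpleGraph.Walk.map_cons, passageTime, passageTime_map w φ p]
    rfl

lemma passageTime_congr : ∀ {x y : ℤ × ℤ} (γ : latticeGraph.Walk x y),
    (∀ e : Edge, e.1 ∈ γ.edges → w e = w' e) → passageTime w γ = passageTime w' γ
  | _, _, .nil, _ => rfl
  | _, _, .cons _ p, H => by
    simp only [passageTime]
    rw [passageTime_congr p fun e he => H e (by simp [he]), H _ (by simp)]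

@[fun_prop]
lemma measurable_passageTime : ∀ {x y : ℤ × ℤ} (γ : latticeGraph.Walk x y),
    Measurable fun w : Edge → ℝ => passageTime w γ
  | _, _, .nil => measurable_const
  | _, _, .cons _ p => (measurable_pi_apply _).add (measurable_passageTime p)

end PassageTime

/-- The infimum of the passage times of the paths from `x` to `y` whose edges lie in `F`; it is `∞`
if there is no such path. Negative passage times count as `0`. -/
noncomputable def restrictedTime (F : Set (Sym2 (ℤ × ℤ))) (x y : ℤ × ℤ) (w : Edge → ℝ) : ℝ≥0∞ :=
  ⨅ (γ : latticeGraph.Walk x y) (_ : ∀ e ∈ γ.edges, e ∈ F), ENNReal.ofReal (passageTime w γ)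

section RestrictedTime

variable {w : Edge → ℝ} {x y : ℤ × ℤ} {F F' : Set (Sym2 (ℤ × ℤ))}

lemma restrictedTime_le (γ : latticeGraph.Walk x y) (hγ : ∀ e ∈ γ.edges, e ∈ F) :
    restrictedTime F x y w ≤ ENNReal.ofReal (passageTime w γ) :=
  iInf₂_le γ hγ

lemma restrictedTime_lt_iff {r : ℝ≥0∞} :
    restrictedTime F x y w < r ↔
      ∃ γ : latticeGraph.Walk x y, (∀ e ∈ γ.edges, e ∈ F) ∧
        ENNReal.ofReal (passageTime w γ) < r := by
  simp only [restrictedTime, iInf_lt_iff, exists_prop]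

lemma restrictedTime_anti (hF : F ⊆ F') : restrictedTime F' x y w ≤ restrictedTime F x y w :=
  le_iInf₂ fun γ hγ => restrictedTime_le γ fun e he => hF (hγ e he)

@[simp]
lemma restrictedTime_self : restrictedTime F x x w = 0 :=
  nonpos_iff_eq_zero.1 <| (restrictedTime_le .nil (by simp)).trans_eq (by simp [passageTime])

lemma restrictedTime_triangle (F : Set (Sym2 (ℤ × ℤ))) (x y z : ℤ × ℤ) (w : Edge → ℝ) :
    restrictedTime F x z w ≤ restrictedTime F x y w + restrictedTime F y z w := by
  refine ENNReal.le_iInf₂_add_iInf₂ fun γ hγ γ' hγ' => ?_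
  calc restrictedTime F x z w
      ≤ ENNReal.ofReal (passageTime w (γ.append γ')) :=
        restrictedTime_le _ fun e he => by
          rw [SimpleGraph.Walk.edges_append, List.mem_append] at he
          exact he.elim (hγ e) (hγ' e)
    _ ≤ _ := by rw [passageTime_append]; exact ENNReal.ofReal_add_le

lemma restrictedTime_symm (F : Set (Sym2 (ℤ × ℤ))) (x y : ℤ × ℤ) (w : Edge → ℝ) :
    restrictedTime F x y w = restrictedTime F y x w := by
  have key : ∀ x y : ℤ × ℤ, restrictedTime F x y w ≤ restrictedTime F y x w := fun x y =>
    le_iInf₂ fun γ hγ => by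
      rw [← passageTime_reverse]
      exact restrictedTime_le _ fun e he => hγ e (by simpa using he)
  exact (key x y).antisymm (key y x)

lemma restrictedTime_map_le (φ : latticeGraph ≃g latticeGraph)
    (hF : ∀ e ∈ F, Sym2.map φ e ∈ F') :
    restrictedTime F' (φ x) (φ y) w ≤ restrictedTime F x y (w ∘ φ.mapEdgeSet) :=
  le_iInf₂ fun γ hγ => by
    rw [← passageTime_map]
    refine restrictedTime_le (γ.map φ.toHom) fun e he => ?_
    rw [SimpleGraph.Walk.edges_map, List.mem_map] at he
    obtain ⟨e', he', rfl⟩ := he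
    exact hF _ (hγ e' he')

lemma dependsOn_restrictedTime :
    DependsOn (restrictedTime F x y) {e : Edge | e.1 ∈ F} := fun w w' h => by
  unfold restrictedTime
  congr! 4 with γ hγ
  exact passageTime_congr γ fun e he => h e (hγ _ he)

@[fun_prop]
lemma measurable_restrictedTime : Measurable (restrictedTime F x y) :=
  Measurable.iInf fun γ => Measurable.iInf fun _ => by fun_prop

lemma restrictedTime_le_edge (h : latticeGraph.Adj x y) (hF : s(x, y) ∈ F) :
    restrictedTime F x y w ≤ ENNReal.ofReal (w ⟨s(x, y), h⟩) :=
  (restrictedTime_le (.cons h .nil) (by simpa using hF)).trans_eq (by simp [passageTime])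

lemma restrictedTime_le_sum (F : Set (Sym2 (ℤ × ℤ))) (w : Edge → ℝ) (v : ℕ → ℤ × ℤ) (m : ℕ) :
    restrictedTime F (v 0) (v m) w
      ≤ ∑ i ∈ Finset.range m, restrictedTime F (v i) (v (i + 1)) w := by
  induction m with
  | zero => simp
  | succ m ih =>
    rw [Finset.sum_range_succ]
    exact (restrictedTime_triangle F _ (v m) _ w).trans (by gcongr)

end RestrictedTime

/-- The lattice automorphism `v ↦ v + a`. -/
def shift (a : ℤ × ℤ) : latticeGraph ≃g latticeGraph where
  toEquiv := Equiv.addRight a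
  map_rel_iff' := by intro x y; simp [latticeGraph]

/-- The lattice automorphism that exchanges the coordinates. -/
def swap : latticeGraph ≃g latticeGraph where
  toEquiv := Equiv.prodComm ℤ ℤ
  map_rel_iff' := by intro x y; simp [latticeGraph, add_comm]

@[simp] lemma shift_apply (a v : ℤ × ℤ) : shift a v = v + a := rfl

@[simp] lemma swap_apply (v : ℤ × ℤ) : swap v = (v.2, v.1) := rfl

/-- The edge from `v` to its right neighbour. -/
def rightEdge (v : ℤ × ℤ) : Edge := ⟨s(v, v + (1, 0)), by simp [latticeGraph]⟩

/-- The edge from `v` to its upper neighbour. -/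
def upEdge (v : ℤ × ℤ) : Edge := ⟨s(v, v + (0, 1)), by simp [latticeGraph]⟩

lemma rightEdge_injective : Function.Injective rightEdge := by
  intro u v h
  have h' := congrArg Subtype.val h
  simp only [rightEdge, Sym2.eq_iff, Prod.ext_iff, Prod.fst_add, Prod.snd_add] at h'
  ext <;> lia

lemma upEdge_injective : Function.Injective upEdge := by
  intro u v h
  have h' := congrArg Subtype.val h
  simp only [upEdge, Sym2.eq_iff, Prod.ext_iff, Prod.fst_add, Prod.snd_add] at h'
  ext <;> lia

section Segments

variable {F : Set (Sym2 (ℤ × ℤ))} {w : Edge → ℝ} {a h : ℤ} {m : ℕ}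

lemma restrictedTime_le_sum_rightEdge
    (hF : ∀ i < m, (rightEdge (a + (i : ℤ), h)).1 ∈ F) :
    restrictedTime F (a, h) (a + (m : ℤ), h) w
      ≤ ∑ i ∈ Finset.range m, ENNReal.ofReal (w (rightEdge (a + (i : ℤ), h))) := by
  have hstep : ∀ i < m, restrictedTime F (a + (i : ℤ), h) (a + ((i + 1 : ℕ) : ℤ), h) w
      ≤ ENNReal.ofReal (w (rightEdge (a + (i : ℤ), h))) := fun i hi => by
    have heq : (a + ((i + 1 : ℕ) : ℤ), h) = (a + (i : ℤ), h) + (1, 0) := by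
      ext <;> simp [add_assoc]
    rw [heq]
    exact restrictedTime_le_edge (rightEdge _).2 (hF i hi)
  simpa using (restrictedTime_le_sum F w (fun i : ℕ => (a + (i : ℤ), h)) m).trans
    (Finset.sum_le_sum fun i hi => hstep i (Finset.mem_range.1 hi))

lemma restrictedTime_le_sum_upEdge
    (hF : ∀ i < m, (upEdge (a, h + (i : ℤ))).1 ∈ F) :
    restrictedTime F (a, h) (a, h + (m : ℤ)) w
      ≤ ∑ i ∈ Finset.range m, ENNReal.ofReal (w (upEdge (a, h + (i : ℤ)))) := by
  have hstep : ∀ i < m, restrictedTime F (a, h + (i : ℤ)) (a, h + ((i + 1 : ℕ) : ℤ)) w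
      ≤ ENNReal.ofReal (w (upEdge (a, h + (i : ℤ)))) := fun i hi => by
    have heq : (a, h + ((i + 1 : ℕ) : ℤ)) = (a, h + (i : ℤ)) + (0, 1) := by
      ext <;> simp [add_assoc]
    rw [heq]
    exact restrictedTime_le_edge (upEdge _).2 (hF i hi)
  simpa using (restrictedTime_le_sum F w (fun i : ℕ => (a, h + (i : ℤ))) m).trans
    (Finset.sum_le_sum fun i hi => hstep i (Finset.mem_range.1 hi))

lemma ofReal_pointToPoint (w : Edge → ℝ) (n : ℕ) :
    ENNReal.ofReal (pointToPoint w n) = restrictedTime Set.univ (0, 0) ((n : ℤ), 0) w := by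
  have hlt : restrictedTime Set.univ (0, 0) ((n : ℤ), 0) w < ∞ := by
    have := restrictedTime_le_sum_rightEdge (F := Set.univ) (w := w) (a := 0) (h := 0) (m := n)
      fun _ _ => Set.mem_univ _
    rw [zero_add] at this
    exact this.trans_lt (ENNReal.sum_lt_top.2 fun _ _ => ENNReal.ofReal_lt_top)
  obtain ⟨γ, -⟩ := restrictedTime_lt_iff.1 hlt
  have : Nonempty (latticeGraph.Walk ((0 : ℤ), (0 : ℤ)) ((n : ℤ), 0)) := ⟨γ⟩
  rw [pointToPoint, ENNReal.ofReal_iInf]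
  simp [restrictedTime]

end Segments

section ReverseFatou

variable {α : Type*} [MeasurableSpace α] {μ : Measure α}

/- Reverse Fatou for `min (f n) g`, whose domination is by a single function. -/
lemma limsup_lintegral_le_of_le_add {f h : ℕ → α → ℝ≥0∞} {g : α → ℝ≥0∞}
    (hf : ∀ n, Measurable (f n)) (hg : Measurable g) (hfgh : ∀ n, f n ≤ g + h n)
    (hg_fin : ∫⁻ x, g x ∂μ ≠ ∞) (hh : Tendsto (fun n => ∫⁻ x, h n x ∂μ) atTop (𝓝 0)) :
    limsup (fun n => ∫⁻ x, f n x ∂μ) atTop ≤ ∫⁻ x, limsup (fun n => f n x) atTop ∂μ := by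
  have hsplit : ∀ n x, f n x ≤ min (f n x) (g x) + h n x := fun n x => by
    rcases le_total (f n x) (g x) with hle | hle
    · simp [hle]
    · simpa [hle] using hfgh n x
  calc limsup (fun n => ∫⁻ x, f n x ∂μ) atTop
      ≤ limsup (fun n => ∫⁻ x, min (f n x) (g x) ∂μ + ∫⁻ x, h n x ∂μ) atTop :=
        limsup_le_limsup (.of_forall fun n => (lintegral_mono (hsplit n)).trans_eq
          (lintegral_add_left ((hf n).min hg) _))
    _ = limsup (fun n => ∫⁻ x, min (f n x) (g x) ∂μ) atTop :=
        ENNReal.limsup_add_of_right_tendsto_zero hh _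
    _ ≤ ∫⁻ x, limsup (fun n => min (f n x) (g x)) atTop ∂μ :=
        limsup_lintegral_le g (fun n => (hf n).min hg)
          (fun n => .of_forall fun x => min_le_right _ _) hg_fin
    _ ≤ ∫⁻ x, limsup (fun n => f n x) atTop ∂μ :=
        lintegral_mono fun x => limsup_le_limsup (.of_forall fun n => min_le_left _ _)

end ReverseFatou

section Independence

variable {Ω ι κ : Type*} {mΩ : MeasurableSpace Ω} {P : Measure Ω}

lemma iIndep_iSup_of_pairwise_disjoint {m : ι → MeasurableSpace Ω} (hm : ∀ i, m i ≤ mΩ)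
    (h : iIndep m P) {S : κ → Set ι} (hS : Pairwise (Function.onFun Disjoint S)) :
    iIndep (fun k => ⨆ i ∈ S k, m i) P := by
  classical
  have := h.isProbabilityMeasure
  refine (iIndep_iff _ _).2 fun A f hf => ?_
  induction A using Finset.induction_on with
  | empty => simp
  | insert k A hk ih =>
    have hdisj : Disjoint (S k) (⋃ j ∈ A, S j) :=
      Set.disjoint_iUnion₂_right.2 fun j hj => hS (ne_of_mem_of_not_mem hj hk).symm
    have hmeas : MeasurableSet[⨆ i ∈ ⋃ j ∈ A, S j, m i] (⋂ j ∈ A, f j) :=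
      MeasurableSet.biInter A.countable_toSet fun j hj =>
        (biSup_mono fun _ hi => Set.mem_biUnion hj hi : (⨆ i ∈ S j, m i) ≤ _) _
          (hf j (Finset.mem_insert_of_mem hj))
    rw [Finset.set_biInter_insert, Finset.prod_insert hk,
      ← ih fun j hj => hf j (Finset.mem_insert_of_mem hj)]
    exact (Indep_iff _ _ _).1 (indep_iSup_of_disjoint hm h hdisj) _ _
      (hf k (Finset.mem_insert_self _ _)) hmeas

lemma measurable_comp_of_dependsOn {β : ι → Type*} [∀ i, MeasurableSpace (β i)]
    {γ : Type*} [MeasurableSpace γ] {X : ∀ i, Ω → β i} {f : (∀ i, β i) → γ} (hf : Measurable f)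
    {S : Set ι} (hfS : DependsOn f S) (hX : ∀ i ∈ S, Measurable (X i)) :
    Measurable fun ω => f (X · ω) := by
  classical
  rcases isEmpty_or_nonempty Ω with hΩ | ⟨⟨ω₀⟩⟩
  · exact measurable_of_empty _
  let Y : Ω → ∀ i, β i := fun ω i => if i ∈ S then X i ω else X i ω₀
  have hY : Measurable Y := measurable_pi_lambda _ fun i => by
    by_cases hi : i ∈ S
    · simpa only [Y, if_pos hi] using hX i hi
    · simp only [Y, if_neg hi, measurable_const]
  have hXY : (fun ω => f (X · ω)) = f ∘ Y := funext fun ω => hfS fun i hi => (if_pos hi).symm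
  exact hXY ▸ hf.comp hY

lemma iIndepFun_comp_of_dependsOn {β : ι → Type*} [∀ i, MeasurableSpace (β i)]
    {γ : κ → Type*} [∀ k, MeasurableSpace (γ k)] {X : ∀ i, Ω → β i} (hX : ∀ i, Measurable (X i))
    (h : iIndepFun X P) {f : ∀ k, (∀ i, β i) → γ k} (hf : ∀ k, Measurable (f k))
    {S : κ → Set ι} (hfS : ∀ k, DependsOn (f k) (S k))
    (hS : Pairwise (Function.onFun Disjoint S)) :
    iIndepFun (fun k ω => f k (X · ω)) P := by
  have hindep := iIndep_iSup_of_pairwise_disjoint (fun i => (hX i).comap_le) h.iIndep hS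
  refine (iIndepFun_iff_iIndep _ _ _).2 ((iIndep_iff _ _).2 fun A s hs => hindep.meas_biInter
    fun k hk => ?_)
  have hmeas : Measurable[⨆ i ∈ S k, MeasurableSpace.comap (X i) inferInstance]
      fun ω => f k (X · ω) :=
    @measurable_comp_of_dependsOn _ _ (_) _ _ _ _ _ _ (hf k) _ (hfS k) fun i hi =>
      (comap_measurable (X i)).mono
        (le_biSup (fun i => MeasurableSpace.comap (X i) inferInstance) hi) le_rfl
  exact hmeas.comap_le _ (hs k hk)

end Independence

section ExponentialMoments

variable {Ω : Type*} {mΩ : MeasurableSpace Ω} {P : Measure Ω} {X : Ω → ℝ}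

lemma Iic_subset_integrableExpSet (hX : ∀ ω, 0 ≤ X ω) (hX_meas : Measurable X) {c : ℝ}
    (h : c ∈ integrableExpSet X P) : Set.Iic c ⊆ integrableExpSet X P := fun θ hθ => by
  refine Integrable.mono' h (hX_meas.const_mul θ).exp.aestronglyMeasurable
    (.of_forall fun ω => ?_)
  rw [Real.norm_of_nonneg (Real.exp_nonneg _)]
  exact Real.exp_le_exp.2 (mul_le_mul_of_nonneg_right hθ (hX ω))

lemma zero_mem_interior_integrableExpSet (hX : ∀ ω, 0 ≤ X ω) (hX_meas : Measurable X) {c : ℝ}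
    (hc : 0 < c) (h : c ∈ integrableExpSet X P) : 0 ∈ interior (integrableExpSet X P) :=
  mem_interior_iff_mem_nhds.2 <|
    mem_of_superset (Iic_mem_nhds hc) (Iic_subset_integrableExpSet hX hX_meas h)

lemma eventually_mgf_le_exp [IsProbabilityMeasure P] (h : 0 ∈ interior (integrableExpSet X P))
    {r : ℝ} (hr : P[X] < r) : ∀ᶠ θ in 𝓝[>] 0, mgf X P θ ≤ Real.exp (θ * r) := by
  have hderiv : HasDerivAt (cgf X P) P[X] 0 := by
    have := (analyticAt_cgf h).differentiableAt.hasDerivAt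
    rwa [deriv_cgf_zero h, probReal_univ, div_one] at this
  have hslope := (hasDerivAt_iff_tendsto_slope.1 hderiv).eventually_lt_const hr
  have hdom : ∀ᶠ θ in 𝓝 0, θ ∈ integrableExpSet X P := mem_interior_iff_mem_nhds.1 h
  filter_upwards [hslope.filter_mono (nhdsWithin_mono 0 fun _ => ne_of_gt),
    nhdsWithin_le_nhds hdom, self_mem_nhdsWithin] with θ hθ hint hpos
  rw [slope_def_field, cgf_zero, sub_zero, sub_zero, div_lt_iff₀ hpos] at hθ
  rw [← exp_cgf hint]
  exact Real.exp_le_exp.2 (by linarith)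

end ExponentialMoments

section Counting

variable {Ω ι : Type*} {mΩ : MeasurableSpace Ω} {P : Measure Ω}

lemma exp_mul_indicator_one (ρ : ℝ) (A : Set Ω) (ω : Ω) :
    Real.exp (ρ * A.indicator 1 ω) = 1 + A.indicator (fun _ => Real.exp ρ - 1) ω := by
  by_cases hω : ω ∈ A <;> simp [hω]

lemma integrable_exp_mul_indicator_one [IsFiniteMeasure P] (ρ : ℝ) {A : Set Ω}
    (hA : MeasurableSet A) :
    Integrable (fun ω => Real.exp (ρ * A.indicator 1 ω)) P := by
  simp only [exp_mul_indicator_one]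
  exact (integrable_const _).add ((integrable_const _).indicator hA)

lemma mgf_indicator_one [IsProbabilityMeasure P] (ρ : ℝ) {A : Set Ω} (hA : MeasurableSet A) :
    mgf (A.indicator 1) P ρ = 1 + P.real A * (Real.exp ρ - 1) := by
  simp only [mgf, exp_mul_indicator_one]
  rw [integral_add (integrable_const _) ((integrable_const _).indicator hA),
    integral_indicator_const _ hA]
  simp

/- Chernoff's bound with parameter `ρ`: each indicator has exponential moment at most `2`. -/
lemma measureReal_le_card_filter_le {A : ι → Set Ω} [∀ ω, DecidablePred fun i => ω ∈ A i]
    (hA : ∀ i, MeasurableSet (A i)) (h : iIndepSet A P) {ρ : ℝ} (hρ : 0 ≤ ρ)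
    (hPA : ∀ i, P.real (A i) ≤ Real.exp (-ρ)) (s : Finset ι) (m : ℝ) :
    P.real {ω | m ≤ (s.filter fun i => ω ∈ A i).card} ≤ 2 ^ s.card * Real.exp (-(ρ * m)) := by
  let X : ι → Ω → ℝ := fun i => (A i).indicator 1
  have hX : iIndepFun X P := h.iIndepFun_indicator
  have := hX.isProbabilityMeasure
  have hX_meas : ∀ i, Measurable (X i) := fun i => measurable_const.indicator (hA i)
  have hcard : ∀ ω, ((s.filter fun i => ω ∈ A i).card : ℝ) = (∑ i ∈ s, X i) ω := fun ω => by
    simp [X, Set.indicator_apply]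
  have hmgf : ∀ i, mgf (X i) P ρ ≤ 2 := fun i => by
    have h1 : P.real (A i) * (Real.exp ρ - 1) ≤ Real.exp (-ρ) * Real.exp ρ :=
      mul_le_mul (hPA i) (by linarith) (by linarith [Real.one_le_exp hρ]) (Real.exp_nonneg _)
    rw [← Real.exp_add, neg_add_cancel, Real.exp_zero] at h1
    linarith [mgf_indicator_one (P := P) ρ (hA i)]
  calc P.real {ω | m ≤ (s.filter fun i => ω ∈ A i).card}
      = P.real {ω | m ≤ (∑ i ∈ s, X i) ω} := by simp only [hcard]
    _ ≤ Real.exp (-ρ * m) * mgf (∑ i ∈ s, X i) P ρ :=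
        measure_ge_le_exp_mul_mgf m hρ (hX.integrable_exp_mul_sum hX_meas
          fun i _ => integrable_exp_mul_indicator_one ρ (hA i))
    _ ≤ Real.exp (-ρ * m) * 2 ^ s.card := by
        rw [hX.mgf_sum hX_meas]
        gcongr
        exact (Finset.prod_le_prod (fun _ _ => mgf_nonneg) fun i _ => hmgf i).trans_eq (by simp)
    _ = 2 ^ s.card * Real.exp (-(ρ * m)) := by rw [neg_mul, mul_comm]

end Counting

/-- I.i.d. nonnegative edge weights with a finite exponential moment. The weights are nonnegative
everywhere, and not only almost surely, so that pathwise bounds need no exceptional set. -/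
structure IIDWeights {Ω : Type*} [MeasurableSpace Ω] (P : Measure Ω) (t : Edge → Ω → ℝ) :
    Prop where
  measurable : ∀ e, Measurable (t e)
  indep : iIndepFun t P
  ident : ∀ e e', IdentDistrib (t e) (t e') P P
  nonneg : ∀ e ω, 0 ≤ t e ω
  exp_moment : ∃ c₀ : ℝ, 0 < c₀ ∧ ∀ e, Integrable (fun ω => Real.exp (c₀ * t e ω)) P

namespace IIDWeights

variable {Ω : Type*} [MeasurableSpace Ω] {P : Measure Ω} {t : Edge → Ω → ℝ}

lemma measurable_pi (ht : IIDWeights P t) : Measurable fun ω => (t · ω) :=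
  measurable_pi_lambda _ ht.measurable

lemma identDistrib_comp (ht : IIDWeights P t) {β : Type*} [MeasurableSpace β]
    {f : (Edge → ℝ) → β} (hf : Measurable f) (σ : Edge ≃ Edge) :
    IdentDistrib (fun ω => f ((t · ω) ∘ σ)) (fun ω => f (t · ω)) P P :=
  have := ht.indep.isProbabilityMeasure
  (IdentDistrib.pi (fun _ => ht.ident _ _) (ht.indep.precomp σ.injective) ht.indep).comp hf

lemma lintegral_restrictedTime_map_le (ht : IIDWeights P t) (φ : latticeGraph ≃g latticeGraph)
    {F F' : Set (Sym2 (ℤ × ℤ))} (hF : ∀ e ∈ F, Sym2.map φ e ∈ F') (x y : ℤ × ℤ) :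
    ∫⁻ ω, restrictedTime F' (φ x) (φ y) (t · ω) ∂P ≤ ∫⁻ ω, restrictedTime F x y (t · ω) ∂P :=
  (lintegral_mono fun _ => restrictedTime_map_le φ hF).trans_eq
    (ht.identDistrib_comp measurable_restrictedTime φ.mapEdgeSet).lintegral_eq

lemma integrable (ht : IIDWeights P t) (e : Edge) : Integrable (t e) P := by
  have := ht.indep.isProbabilityMeasure
  obtain ⟨c₀, hc₀, h⟩ := ht.exp_moment
  have hint := zero_mem_interior_integrableExpSet (ht.nonneg e) (ht.measurable e) hc₀ (h e)
  simpa using integrable_pow_of_mem_interior_integrableExpSet hint 1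

lemma lintegral_weight_eq (ht : IIDWeights P t) (e e' : Edge) :
    ∫⁻ ω, ENNReal.ofReal (t e ω) ∂P = ∫⁻ ω, ENNReal.ofReal (t e' ω) ∂P :=
  ((ht.ident e e').comp ENNReal.measurable_ofReal).lintegral_eq

lemma lintegral_sum_weight (ht : IIDWeights P t) (u : ℕ → Edge) (m : ℕ) (e : Edge) :
    ∫⁻ ω, ∑ i ∈ Finset.range m, ENNReal.ofReal (t (u i) ω) ∂P
      = m * ∫⁻ ω, ENNReal.ofReal (t e ω) ∂P := by
  rw [lintegral_finsetSum _ fun i _ => (ht.measurable _).ennreal_ofReal]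
  simp [ht.lintegral_weight_eq _ e]

end IIDWeights

section TimeConstant

/-- The passage time of the straight segment from `(0, 0)` to `(n, 0)`. -/
noncomputable def axisTime (w : Edge → ℝ) (n : ℕ) : ℝ :=
  ∑ i ∈ Finset.range n, w (rightEdge ((i : ℤ), 0))

lemma pointToPoint_le_axisTime {w : Edge → ℝ} (hw : ∀ e, 0 ≤ w e) (n : ℕ) :
    pointToPoint w n ≤ axisTime w n := by
  have := restrictedTime_le_sum_rightEdge (F := Set.univ) (w := w) (a := 0) (h := 0) (m := n)
    fun _ _ => Set.mem_univ _
  simp only [zero_add] at this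
  rwa [← ofReal_pointToPoint, ← ENNReal.ofReal_sum_of_nonneg fun i _ => hw _,
    ENNReal.ofReal_le_ofReal_iff (Finset.sum_nonneg fun i _ => hw _)] at this

lemma pointToPoint_div_nonneg {w : Edge → ℝ} (hw : ∀ e, 0 ≤ w e) (n : ℕ) :
    0 ≤ pointToPoint w n / n :=
  div_nonneg (Real.iInf_nonneg fun γ => passageTime_nonneg hw γ) n.cast_nonneg

lemma pointToPoint_div_le {w : Edge → ℝ} (hw : ∀ e, 0 ≤ w e) (n : ℕ) :
    pointToPoint w n / n ≤ axisTime w n / n := by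
  gcongr
  exact pointToPoint_le_axisTime hw n

lemma limsup_nonneg {ι : Type*} {f : Filter ι} [f.NeBot] {u : ι → ℝ} (hu : ∀ i, 0 ≤ u i) :
    0 ≤ limsup u f :=
  Real.sInf_nonneg fun _ ha =>
    have ⟨i, hi⟩ := (eventually_map.1 ha).exists
    (hu i).trans hi

@[fun_prop]
lemma measurable_pointToPoint (n : ℕ) : Measurable fun w => pointToPoint w n :=
  Measurable.iInf fun γ => measurable_passageTime γ

namespace IIDWeights

variable {Ω : Type*} [MeasurableSpace Ω] {P : Measure Ω} {t : Edge → Ω → ℝ}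

lemma timeConstant_nonneg (ht : IIDWeights P t) : 0 ≤ timeConstant P t :=
  have := ht.indep.isProbabilityMeasure
  limsup_nonneg fun ω => limsup_nonneg fun n => pointToPoint_div_nonneg (ht.nonneg · ω) n

lemma pairwise_indepFun_rightEdge (ht : IIDWeights P t) :
    Pairwise (Function.onFun (IndepFun · · P) fun i : ℕ => t (rightEdge ((i : ℤ), 0))) :=
  fun i j hij => ht.indep.indepFun fun h => hij (by simpa using rightEdge_injective h)

lemma tendsto_axisTime_div (ht : IIDWeights P t) :
    ∀ᵐ ω ∂P, Tendsto (fun n : ℕ => axisTime (t · ω) n / n) atTop (𝓝 P[t (rightEdge (0, 0))]) :=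
  strong_law_ae_real (fun i : ℕ => t (rightEdge ((i : ℤ), 0))) (ht.integrable _)
    ht.pairwise_indepFun_rightEdge fun _ => ht.ident _ _

lemma tendsto_lintegral_axisTime_div_sub (ht : IIDWeights P t) :
    Tendsto (fun n : ℕ => ∫⁻ ω, ‖axisTime (t · ω) n / n - P[t (rightEdge (0, 0))]‖ₑ ∂P) atTop
      (𝓝 0) := by
  have := ht.indep.isProbabilityMeasure
  have hlp := strong_law_Lp le_rfl ENNReal.one_ne_top (fun i : ℕ => t (rightEdge ((i : ℤ), 0)))
    (memLp_one_iff_integrable.2 (ht.integrable _)) ht.pairwise_indepFun_rightEdge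
    fun _ => ht.ident _ _
  simpa only [eLpNorm_one_eq_lintegral_enorm, smul_eq_mul, inv_mul_eq_div, axisTime,
    Nat.cast_zero] using hlp

lemma limsup_pointToPoint_div_le_timeConstant (ht : IIDWeights P t) :
    ∀ᵐ ω ∂P, limsup (fun n : ℕ => ENNReal.ofReal (pointToPoint (t · ω) n / n)) atTop
      ≤ ENNReal.ofReal (timeConstant P t) := by
  have hcobdd : ∀ ω, IsCoboundedUnder (· ≤ ·) atTop
      fun n : ℕ => pointToPoint (t · ω) n / n := fun ω =>
    IsCoboundedUnder.of_frequently_ge (a := 0) <| .of_forall fun n =>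
      pointToPoint_div_nonneg (ht.nonneg · ω) n
  have hess : ∀ᵐ ω ∂P, limsup (fun n : ℕ => pointToPoint (t · ω) n / n) atTop
      ≤ timeConstant P t := by
    refine ae_le_essSup ⟨P[t (rightEdge (0, 0))], ?_⟩
    rw [eventually_map]
    filter_upwards [ht.tendsto_axisTime_div] with ω hω
    rw [← hω.limsup_eq]
    exact limsup_le_limsup (.of_forall (pointToPoint_div_le (ht.nonneg · ω))) (hcobdd ω)
      hω.isBoundedUnder_le
  filter_upwards [ht.tendsto_axisTime_div, hess] with ω hω hess
  have hmap := ENNReal.ofReal_mono.map_limsup_of_continuousAt _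
    ENNReal.continuous_ofReal.continuousAt
    (hω.isBoundedUnder_le.mono_le (.of_forall (pointToPoint_div_le (ht.nonneg · ω)))) (hcobdd ω)
  exact hmap.symm.trans_le (ENNReal.ofReal_le_ofReal hess)

lemma limsup_lintegral_pointToPoint_div_le (ht : IIDWeights P t) :
    limsup (fun n : ℕ => ∫⁻ ω, ENNReal.ofReal (pointToPoint (t · ω) n / n) ∂P) atTop
      ≤ ENNReal.ofReal (timeConstant P t) := by
  have := ht.indep.isProbabilityMeasure
  have hmeas : ∀ n, Measurable fun ω => ENNReal.ofReal (pointToPoint (t · ω) n / n) := fun n =>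
    (((measurable_pointToPoint n).comp ht.measurable_pi).div_const _).ennreal_ofReal
  have hle : ∀ n ω, ENNReal.ofReal (pointToPoint (t · ω) n / n)
      ≤ ENNReal.ofReal P[t (rightEdge (0, 0))]
        + ‖axisTime (t · ω) n / n - P[t (rightEdge (0, 0))]‖ₑ :=
    fun n ω => by
      have hreal : pointToPoint (t · ω) n / n ≤ P[t (rightEdge (0, 0))]
          + |axisTime (t · ω) n / n - P[t (rightEdge (0, 0))]| := by
        have hdiv := pointToPoint_div_le (ht.nonneg · ω) n
        linarith [le_abs_self (axisTime (t · ω) n / n - P[t (rightEdge (0, 0))])]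
      rw [Real.enorm_eq_ofReal_abs]
      exact (ENNReal.ofReal_le_ofReal hreal).trans ENNReal.ofReal_add_le
  calc _ ≤ ∫⁻ ω, limsup (fun n : ℕ => ENNReal.ofReal (pointToPoint (t · ω) n / n)) atTop ∂P :=
        limsup_lintegral_le_of_le_add hmeas measurable_const hle (by simp)
          ht.tendsto_lintegral_axisTime_div_sub
    _ ≤ ∫⁻ _, ENNReal.ofReal (timeConstant P t) ∂P :=
        lintegral_mono_ae ht.limsup_pointToPoint_div_le_timeConstant
    _ = ENNReal.ofReal (timeConstant P t) := by simp

lemma exists_lintegral_restrictedTime_univ_lt (ht : IIDWeights P t) {τ : ℝ}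
    (hτ : timeConstant P t < τ) :
    ∃ N : ℕ, ∫⁻ ω, restrictedTime Set.univ (0, 0) ((N : ℤ), 0) (t · ω) ∂P
      < ENNReal.ofReal (τ * N) := by
  have hτ_pos := ht.timeConstant_nonneg.trans_lt hτ
  have hlt := ht.limsup_lintegral_pointToPoint_div_le.trans_lt
    ((ENNReal.ofReal_lt_ofReal_iff hτ_pos).2 hτ)
  obtain ⟨N, hN, hN_pos⟩ := ((eventually_lt_of_limsup_lt hlt).and (eventually_gt_atTop 0)).exists
  have hN' : (0 : ℝ) < N := by exact_mod_cast hN_pos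
  refine ⟨N, ?_⟩
  have hfactor : ∀ ω, restrictedTime Set.univ (0, 0) ((N : ℤ), 0) (t · ω)
      = ENNReal.ofReal (pointToPoint (t · ω) N / N) * ENNReal.ofReal N := fun ω => by
    rw [← ofReal_pointToPoint, ← ENNReal.ofReal_mul' hN'.le, div_mul_cancel₀ _ hN'.ne']
  simp only [hfactor]
  rw [lintegral_mul_const' _ _ ENNReal.ofReal_ne_top, ENNReal.ofReal_mul hτ_pos.le]
  exact ENNReal.mul_lt_mul_left (by simpa using hN_pos.ne') ENNReal.ofReal_ne_top hN

end IIDWeights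

end TimeConstant

section Squares

/-- The pairs of points of the square `[-M, M]²`. -/
def squareEdges (M : ℕ) : Set (Sym2 (ℤ × ℤ)) := {e | ∀ v ∈ e, |v.1| ≤ M ∧ |v.2| ≤ M}

lemma squareEdges_mono : Monotone squareEdges := fun M M' hM e he v hv => by
  have := he v hv
  lia

lemma eventually_edges_subset_squareEdges {x y : ℤ × ℤ} (γ : latticeGraph.Walk x y) :
    ∀ᶠ M in atTop, ∀ e ∈ γ.edges, e ∈ squareEdges M := by
  refine (γ.edges.finite_toSet.eventually_all).2 fun e _ => ?_
  induction e using Sym2.ind with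
  | _ u v =>
    filter_upwards [eventually_ge_atTop
      (u.1.natAbs + u.2.natAbs + v.1.natAbs + v.2.natAbs)] with M hM
    simp only [squareEdges, Set.mem_ofPred_eq, Sym2.mem_iff, abs_le]
    rintro _ (rfl | rfl) <;> lia

lemma antitone_restrictedTime_squareEdges (x y : ℤ × ℤ) (w : Edge → ℝ) :
    Antitone fun M => restrictedTime (squareEdges M) x y w := fun _ _ hM =>
  restrictedTime_anti (squareEdges_mono hM)

lemma iInf_restrictedTime_squareEdges (N : ℕ) (x y : ℤ × ℤ) (w : Edge → ℝ) :
    ⨅ M, restrictedTime (squareEdges (N + M)) x y w = restrictedTime Set.univ x y w := by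
  refine le_antisymm (le_iInf₂ fun γ _ => ?_)
    (le_iInf fun M => restrictedTime_anti (Set.subset_univ _))
  obtain ⟨M, hM⟩ := (eventually_edges_subset_squareEdges γ).exists
  exact (iInf_le _ M).trans (restrictedTime_le γ fun e he =>
    squareEdges_mono (Nat.le_add_left M N) (hM e he))

lemma rightEdge_mem_squareEdges {N i : ℕ} (hi : i < N) :
    (rightEdge ((i : ℤ), 0)).1 ∈ squareEdges N := by
  simp only [rightEdge, squareEdges, Set.mem_ofPred_eq, Sym2.mem_iff, abs_le]
  rintro v (rfl | rfl) <;> simp only [Prod.fst_add, Prod.snd_add] <;> lia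

namespace IIDWeights

variable {Ω : Type*} [MeasurableSpace Ω] {P : Measure Ω} {t : Edge → Ω → ℝ}

lemma lintegral_weight_lt_top (ht : IIDWeights P t) (e : Edge) :
    ∫⁻ ω, ENNReal.ofReal (t e ω) ∂P < ∞ :=
  (ht.integrable e).lintegral_lt_top

lemma exists_lintegral_restrictedTime_squareEdges_lt (ht : IIDWeights P t) {τ : ℝ}
    (hτ : timeConstant P t < τ) :
    ∃ N M : ℕ, ∫⁻ ω, restrictedTime (squareEdges M) (0, 0) ((N : ℤ), 0) (t · ω) ∂P
      < ENNReal.ofReal (τ * N) := by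
  obtain ⟨N, hN⟩ := ht.exists_lintegral_restrictedTime_univ_lt hτ
  have hfin : ∫⁻ ω, restrictedTime (squareEdges (N + 0)) (0, 0) ((N : ℤ), 0) (t · ω) ∂P ≠ ∞ := by
    have hle : ∀ ω, restrictedTime (squareEdges N) (0, 0) ((N : ℤ), 0) (t · ω)
        ≤ ∑ i ∈ Finset.range N, ENNReal.ofReal (t (rightEdge ((i : ℤ), 0)) ω) := fun ω => by
      simpa using restrictedTime_le_sum_rightEdge (w := (t · ω)) (a := 0) (h := 0)
        fun i (hi : i < N) => by simpa using rightEdge_mem_squareEdges hi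
    refine ((lintegral_mono hle).trans_lt ?_).ne
    rw [ht.lintegral_sum_weight _ N (rightEdge (0, 0))]
    exact ENNReal.mul_lt_top (ENNReal.natCast_lt_top N) (ht.lintegral_weight_lt_top _)
  have hiInf := lintegral_iInf (μ := P)
    (f := fun M ω => restrictedTime (squareEdges (N + M)) (0, 0) ((N : ℤ), 0) (t · ω))
    (fun _ => measurable_restrictedTime.comp ht.measurable_pi)
    (fun _ _ hM ω => antitone_restrictedTime_squareEdges (0, 0) ((N : ℤ), 0) (t · ω)
      (Nat.add_le_add_left hM N)) hfin
  simp only [iInf_restrictedTime_squareEdges] at hiInf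
  rw [hiInf, iInf_lt_iff] at hN
  exact ⟨N, N + hN.choose, hN.choose_spec⟩

end IIDWeights

end Squares

section Boxes

/-- The pairs of points of the box `v + [-M, M] × [0, L]` that do not lie in its bottom side.
Without the bottom side, boxes stacked on top of each other have no edge in common. -/
def boxEdges (L M : ℕ) (v : ℤ × ℤ) : Set (Sym2 (ℤ × ℤ)) :=
  {e | (∀ u ∈ e, |u.1 - v.1| ≤ M ∧ v.2 ≤ u.2 ∧ u.2 ≤ v.2 + L) ∧ ∃ u ∈ e, v.2 < u.2}

lemma upEdge_mem_boxEdges {L : ℕ} (M : ℕ) {v : ℤ × ℤ} {h : ℤ} (h_ge : v.2 ≤ h)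
    (h_lt : h < v.2 + L) :
    (upEdge (v.1, h)).1 ∈ boxEdges L M v := by
  simp only [upEdge, boxEdges, Set.mem_ofPred_eq, Sym2.mem_iff, abs_le]
  refine ⟨?_, (v.1, h) + (0, 1), Or.inr rfl, ?_⟩
  · rintro u (rfl | rfl) <;> simp only [Prod.fst_add, Prod.snd_add] <;> lia
  · simp only [Prod.snd_add]
    lia

lemma map_swap_shift_mem_boxEdges {L M : ℕ} {h : ℤ} (hM : M < h) (hL : h + M ≤ L)
    {e : Sym2 (ℤ × ℤ)} (he : e ∈ squareEdges M) :
    Sym2.map (swap.trans (shift (0, h))) e ∈ boxEdges L M (0, 0) := by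
  have hbounds : ∀ v ∈ e, |v.2| ≤ M ∧ 0 < v.1 + h ∧ v.1 + h ≤ L := fun v hv => by
    have := he v hv
    rw [abs_le] at this
    lia
  refine ⟨fun v hv => ?_, ?_⟩
  · obtain ⟨u, hu, rfl⟩ := Sym2.mem_map.1 hv
    simpa using ⟨(hbounds u hu).1, (hbounds u hu).2.1.le, (hbounds u hu).2.2⟩
  · refine ⟨_, Sym2.mem_map.2 ⟨_, e.out_fst_mem, rfl⟩, ?_⟩
    simpa using (hbounds _ e.out_fst_mem).2.1

lemma map_shift_mem_boxEdges {L M : ℕ} {e : Sym2 (ℤ × ℤ)} (v : ℤ × ℤ)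
    (he : e ∈ boxEdges L M (0, 0)) : Sym2.map (shift v) e ∈ boxEdges L M v := by
  refine ⟨fun u hu => ?_, ?_⟩
  · obtain ⟨u', hu', rfl⟩ := Sym2.mem_map.1 hu
    have := he.1 u' hu'
    simp only [shift_apply, Prod.fst_add, Prod.snd_add, abs_le] at this ⊢
    lia
  · obtain ⟨u, hu, hpos⟩ := he.2
    exact ⟨_, Sym2.mem_map.2 ⟨u, hu, rfl⟩, by simpa using hpos⟩

namespace IIDWeights

variable {Ω : Type*} [MeasurableSpace Ω] {P : Measure Ω} {t : Edge → Ω → ℝ}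
  {F : Set (Sym2 (ℤ × ℤ))}

lemma lintegral_restrictedTime_triangle (ht : IIDWeights P t) (x y z : ℤ × ℤ) :
    ∫⁻ ω, restrictedTime F x z (t · ω) ∂P
      ≤ ∫⁻ ω, restrictedTime F x y (t · ω) ∂P + ∫⁻ ω, restrictedTime F y z (t · ω) ∂P :=
  (lintegral_mono fun _ => restrictedTime_triangle F x y z _).trans_eq
    (lintegral_add_left (measurable_restrictedTime.comp ht.measurable_pi) _)

lemma lintegral_restrictedTime_le_sum (ht : IIDWeights P t) (v : ℕ → ℤ × ℤ) (m : ℕ) :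
    ∫⁻ ω, restrictedTime F (v 0) (v m) (t · ω) ∂P
      ≤ ∑ i ∈ Finset.range m, ∫⁻ ω, restrictedTime F (v i) (v (i + 1)) (t · ω) ∂P :=
  (lintegral_mono fun _ => restrictedTime_le_sum F _ v m).trans_eq
    (lintegral_finsetSum _ fun _ _ => measurable_restrictedTime.comp ht.measurable_pi)

lemma lintegral_restrictedTime_up_le (ht : IIDWeights P t) {a h : ℤ} {m : ℕ}
    (hF : ∀ i < m, (upEdge (a, h + (i : ℤ))).1 ∈ F) (e : Edge) :
    ∫⁻ ω, restrictedTime F (a, h) (a, h + (m : ℤ)) (t · ω) ∂P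
      ≤ m * ∫⁻ ω, ENNReal.ofReal (t e ω) ∂P :=
  (lintegral_mono fun _ => restrictedTime_le_sum_upEdge hF).trans_eq (ht.lintegral_sum_weight _ m e)

lemma lintegral_restrictedTime_boxEdges_le (ht : IIDWeights P t) (N M Q : ℕ) (e : Edge) :
    ∫⁻ ω, restrictedTime (boxEdges (M + 1 + Q * N + M) M (0, 0)) (0, 0)
        (0, ((M + 1 + Q * N + M : ℕ) : ℤ)) (t · ω) ∂P
      ≤ (M + 1 : ℕ) * ∫⁻ ω, ENNReal.ofReal (t e ω) ∂P
        + Q * ∫⁻ ω, restrictedTime (squareEdges M) (0, 0) ((N : ℤ), 0) (t · ω) ∂P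
        + M * ∫⁻ ω, ENNReal.ofReal (t e ω) ∂P := by
  set F := boxEdges (M + 1 + Q * N + M) M (0, 0)
  let v : ℕ → ℤ × ℤ := fun q => (0, ((M + 1 + q * N : ℕ) : ℤ))
  have hbottom : ∫⁻ ω, restrictedTime F (0, 0) (v 0) (t · ω) ∂P
      ≤ (M + 1 : ℕ) * ∫⁻ ω, ENNReal.ofReal (t e ω) ∂P := by
    simpa [v] using ht.lintegral_restrictedTime_up_le (h := 0) (m := M + 1)
      (fun i hi => upEdge_mem_boxEdges M (v := (0, 0)) (by lia) (by lia)) e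
  have htop : ∫⁻ ω, restrictedTime F (v Q) (0, ((M + 1 + Q * N + M : ℕ) : ℤ)) (t · ω) ∂P
      ≤ M * ∫⁻ ω, ENNReal.ofReal (t e ω) ∂P := by
    simpa [v] using ht.lintegral_restrictedTime_up_le (F := F)
      (h := ((M + 1 + Q * N : ℕ) : ℤ)) (m := M)
      (fun i hi => upEdge_mem_boxEdges M (v := (0, 0)) (by lia) (by lia)) e
  have hmiddle : ∀ q ∈ Finset.range Q, ∫⁻ ω, restrictedTime F (v q) (v (q + 1)) (t · ω) ∂P
      ≤ ∫⁻ ω, restrictedTime (squareEdges M) (0, 0) ((N : ℤ), 0) (t · ω) ∂P := fun q hq => by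
    have hqQ : (q + 1) * N ≤ Q * N := Nat.mul_le_mul_right N (Finset.mem_range.1 hq)
    let φ := swap.trans (shift (v q))
    have hφ : φ (0, 0) = v q := zero_add _
    have hφ' : φ ((N : ℤ), 0) = v (q + 1) := by
      ext
      · simp [φ, v]
      · simp only [φ, v, RelIso.trans_apply, swap_apply, shift_apply, Prod.snd_add]
        push_cast
        ring
    rw [← hφ, ← hφ']
    exact ht.lintegral_restrictedTime_map_le φ
      (fun e he => map_swap_shift_mem_boxEdges (by lia) (by lia) he) _ _
  calc _ ≤ ∫⁻ ω, restrictedTime F (0, 0) (v 0) (t · ω) ∂P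
        + ∫⁻ ω, restrictedTime F (v 0) (v Q) (t · ω) ∂P
        + ∫⁻ ω, restrictedTime F (v Q) (0, ((M + 1 + Q * N + M : ℕ) : ℤ)) (t · ω) ∂P :=
        (ht.lintegral_restrictedTime_triangle _ (v Q) _).trans
          (by gcongr; exact ht.lintegral_restrictedTime_triangle _ _ _)
    _ ≤ _ := by
        gcongr
        refine (ht.lintegral_restrictedTime_le_sum v Q).trans ?_
        simpa using Finset.sum_le_card_nsmul _ _ _ hmiddle

lemma exists_lintegral_restrictedTime_boxEdges_lt (ht : IIDWeights P t) {τ : ℝ}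
    (hτ : timeConstant P t < τ) :
    ∃ L M : ℕ, 0 < L ∧ ∫⁻ ω, restrictedTime (boxEdges L M (0, 0)) (0, 0) (0, (L : ℤ)) (t · ω) ∂P
      < ENNReal.ofReal (τ * L) := by
  obtain ⟨N, M, hsquare⟩ := ht.exists_lintegral_restrictedTime_squareEdges_lt hτ
  have hτ_nonneg := ht.timeConstant_nonneg.trans hτ.le
  lift (∫⁻ ω, restrictedTime (squareEdges M) (0, 0) ((N : ℤ), 0) (t · ω) ∂P) to NNReal
    using hsquare.ne_top with s hs
  have hmean := (ht.lintegral_weight_lt_top (upEdge (0, 0))).ne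
  have hle := fun Q => ht.lintegral_restrictedTime_boxEdges_le N M Q (upEdge (0, 0))
  lift (∫⁻ ω, ENNReal.ofReal (t (upEdge (0, 0)) ω) ∂P) to NNReal using hmean with m
  have hgap : 0 < τ * N - s := by
    rw [ENNReal.lt_ofReal_iff_toReal_lt ENNReal.coe_ne_top, ENNReal.coe_toReal] at hsquare
    exact sub_pos.2 hsquare
  obtain ⟨Q, hQ⟩ := exists_nat_gt ((2 * M + 1) * m / (τ * N - s))
  rw [div_lt_iff₀ hgap] at hQ
  refine ⟨M + 1 + Q * N + M, M, by lia, (hle Q).trans_lt ?_⟩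
  rw [← hs, ENNReal.lt_ofReal_iff_toReal_lt (by finiteness)]
  calc ((M + 1 : ℕ) * (m : ℝ≥0∞) + Q * s + M * m).toReal
      = (2 * M + 1) * m + Q * s := by
        rw [ENNReal.toReal_add (by finiteness) (by finiteness),
          ENNReal.toReal_add (by finiteness) (by finiteness)]
        simp only [ENNReal.toReal_mul, ENNReal.toReal_natCast, ENNReal.coe_toReal]
        push_cast
        ring
    _ < τ * (Q * N) := by linarith
    _ ≤ τ * (M + 1 + Q * N + M : ℕ) := by
        gcongr
        push_cast
        linarith [M.cast_nonneg (α := ℝ)]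

end IIDWeights

end Boxes

section BoxTimes

variable {L M : ℕ} {v : ℤ × ℤ} {w : Edge → ℝ}

/-- The time needed to cross the box `v + [-M, M] × [0, L]` upwards from `v`, without using its
bottom side. -/
noncomputable def boxTime (L M : ℕ) (v : ℤ × ℤ) (w : Edge → ℝ) : ℝ :=
  (restrictedTime (boxEdges L M v) v (v + (0, (L : ℤ))) w).toReal

lemma restrictedTime_boxEdges_le_sum :
    restrictedTime (boxEdges L M v) v (v + (0, (L : ℤ))) w
      ≤ ∑ i ∈ Finset.range L, ENNReal.ofReal (w (upEdge (v.1, v.2 + (i : ℤ)))) := by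
  have := restrictedTime_le_sum_upEdge (w := w) (a := v.1) (h := v.2) (m := L)
    fun i hi => upEdge_mem_boxEdges (L := L) (v := v) M (by lia) (by lia)
  rwa [show (v.1, v.2 + (L : ℤ)) = v + (0, (L : ℤ)) by ext <;> simp] at this

lemma restrictedTime_boxEdges_ne_top :
    restrictedTime (boxEdges L M v) v (v + (0, (L : ℤ))) w ≠ ∞ :=
  (restrictedTime_boxEdges_le_sum.trans_lt
    (ENNReal.sum_lt_top.2 fun _ _ => ENNReal.ofReal_lt_top)).ne

lemma boxTime_nonneg : 0 ≤ boxTime L M v w := ENNReal.toReal_nonneg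

@[fun_prop]
lemma measurable_boxTime : Measurable (boxTime L M v) := measurable_restrictedTime.ennreal_toReal

lemma dependsOn_boxTime : DependsOn (boxTime L M v) {e : Edge | e.1 ∈ boxEdges L M v} :=
  fun _ _ h => congrArg ENNReal.toReal (dependsOn_restrictedTime h)

lemma boxTime_le_sum (hw : ∀ e, 0 ≤ w e) :
    boxTime L M v w ≤ ∑ i ∈ Finset.range L, w (upEdge (v.1, v.2 + (i : ℤ))) := by
  refine ENNReal.toReal_le_of_le_ofReal (Finset.sum_nonneg fun _ _ => hw _) ?_
  rw [ENNReal.ofReal_sum_of_nonneg fun _ _ => hw _]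
  exact restrictedTime_boxEdges_le_sum

lemma boxTime_le_comp_shift : boxTime L M v w ≤ boxTime L M (0, 0) (w ∘ (shift v).mapEdgeSet) := by
  refine ENNReal.toReal_mono restrictedTime_boxEdges_ne_top ?_
  have hbottom : shift v (0, 0) = v := zero_add v
  have htop : shift v ((0, 0) + (0, (L : ℤ))) = v + (0, (L : ℤ)) := by ext <;> simp [add_comm]
  have := restrictedTime_map_le (w := w) (x := (0, 0)) (y := (0, 0) + (0, (L : ℤ))) (shift v)
    fun e (he : e ∈ boxEdges L M (0, 0)) => map_shift_mem_boxEdges v he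
  rwa [hbottom, htop] at this

namespace IIDWeights

variable {Ω : Type*} [MeasurableSpace Ω] {P : Measure Ω} {t : Edge → Ω → ℝ}

lemma mem_integrableExpSet_boxTime (ht : IIDWeights P t) {θ : ℝ} (hθ : 0 ≤ θ)
    (h : ∀ e, θ ∈ integrableExpSet (t e) P) (v : ℤ × ℤ) :
    θ ∈ integrableExpSet (fun ω => boxTime L M v (t · ω)) P := by
  have := ht.indep.isProbabilityMeasure
  have hinj : Function.Injective fun i : ℕ => upEdge (v.1, v.2 + (i : ℤ)) := fun i j hij => by
    simpa using upEdge_injective hij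
  refine ((ht.indep.precomp hinj).integrable_exp_mul_sum (fun _ => ht.measurable _)
    (s := Finset.range L) fun _ _ => h _).mono'
      ((measurable_boxTime.comp ht.measurable_pi).const_mul θ).exp.aestronglyMeasurable
      (.of_forall fun ω => ?_)
  rw [Real.norm_of_nonneg (Real.exp_nonneg _), Finset.sum_apply]
  gcongr
  exact boxTime_le_sum (ht.nonneg · ω)

lemma mgf_boxTime_le (ht : IIDWeights P t) {θ : ℝ} (hθ : 0 ≤ θ)
    (h : ∀ e, θ ∈ integrableExpSet (t e) P) (v : ℤ × ℤ) :
    mgf (fun ω => boxTime L M v (t · ω)) P θ ≤ mgf (fun ω => boxTime L M (0, 0) (t · ω)) P θ := by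
  have := ht.identDistrib_comp (f := boxTime L M (0, 0)) (by fun_prop) (shift v).mapEdgeSet
  rw [← mgf_congr_identDistrib this]
  refine mgf_mono_of_nonneg (.of_forall fun ω => boxTime_le_comp_shift) hθ ?_
  exact (this.comp (u := fun r => Real.exp (θ * r)) (by fun_prop)).integrable_iff.2
    (ht.mem_integrableExpSet_boxTime hθ h (0, 0))

lemma exists_mgf_boxTime_le (ht : IIDWeights P t) {τ : ℝ} (hτ : timeConstant P t < τ) :
    ∃ L M : ℕ, 0 < L ∧ ∃ θ : ℝ, 0 < θ ∧ (∀ e, 3 * θ ∈ integrableExpSet (t e) P) ∧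
      ∀ v, mgf (fun ω => boxTime L M v (t · ω)) P θ ≤ Real.exp (θ * (τ * L)) := by
  have := ht.indep.isProbabilityMeasure
  obtain ⟨L, M, hL, hlt⟩ := ht.exists_lintegral_restrictedTime_boxEdges_lt hτ
  obtain ⟨c, hc, hint⟩ := ht.exp_moment
  have hmean : ∫ ω, boxTime L M (0, 0) (t · ω) ∂P < τ * L :=
    (integral_toReal (measurable_restrictedTime.comp ht.measurable_pi).aemeasurable
      (.of_forall fun _ => restrictedTime_boxEdges_ne_top.lt_top)).trans_lt
      (ENNReal.toReal_lt_of_lt_ofReal (by simpa using hlt))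
  have hmem : 0 ∈ interior (integrableExpSet (fun ω => boxTime L M (0, 0) (t · ω)) P) :=
    zero_mem_interior_integrableExpSet (fun _ => boxTime_nonneg)
      (measurable_boxTime.comp ht.measurable_pi) hc
      (ht.mem_integrableExpSet_boxTime hc.le hint (0, 0))
  obtain ⟨θ, hθ, hθc, hθ_pos⟩ := ((eventually_mgf_le_exp hmem hmean).and
    ((eventually_nhdsWithin_of_eventually_nhds (eventually_le_nhds (by positivity : 0 < c / 3))).and
      self_mem_nhdsWithin)).exists
  have hθ_pos : 0 < θ := hθ_pos
  have hθ_mem : ∀ r ≤ c, ∀ e, r ∈ integrableExpSet (t e) P := fun r hr e =>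
    Iic_subset_integrableExpSet (ht.nonneg e) (ht.measurable e) (hint e) hr
  exact ⟨L, M, hL, θ, hθ_pos, hθ_mem _ (by linarith), fun v =>
    (ht.mgf_boxTime_le hθ_pos.le (hθ_mem _ (by linarith)) v).trans hθ⟩

end IIDWeights

end BoxTimes

section Channels

/-- The pairs of points of the strip `[a, b] × ℤ` that do not lie in its right side. Without the
right side, adjacent channels have no edge in common. -/
def channelEdges (a b : ℤ) : Set (Sym2 (ℤ × ℤ)) :=
  {e | (∀ u ∈ e, a ≤ u.1 ∧ u.1 ≤ b) ∧ ∃ u ∈ e, u.1 < b}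

/-- The largest time needed to go from height `h` to height `h'` in the channel `[a, b] × ℤ`, over
all entry and exit points. -/
noncomputable def channelTime (a b h h' : ℤ) (w : Edge → ℝ) : ℝ≥0∞ :=
  ⨆ (p ∈ Set.Icc a b) (q ∈ Set.Icc a b), restrictedTime (channelEdges a b) (p, h) (q, h') w

/-- The horizontal edges at height `h` between the columns `a` and `b`. -/
noncomputable def rowEdges (a b h : ℤ) : Finset Edge :=
  (Finset.Ico a b).map ⟨fun z => rightEdge (z, h), fun _ _ hz =>
    congrArg Prod.fst (rightEdge_injective hz)⟩

/-- The vertical edges in column `x` between the heights `h` and `h'`. -/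
noncomputable def columnEdges (x h h' : ℤ) : Finset Edge :=
  (Finset.Ico h h').map ⟨fun z => upEdge (x, z), fun _ _ hz =>
    congrArg Prod.snd (upEdge_injective hz)⟩

/-- The edges that join a tower of boxes in column `x`, which begins at height `h` and ends at
height `h₁ ≤ h'`, to the points of the channel `[a, b] × ℤ` at the heights `h` and `h'`. -/
noncomputable def connectorEdges (a b x h h₁ h' : ℤ) : Finset Edge :=
  rowEdges a b h ∪ columnEdges x h₁ h' ∪ rowEdges a b h'

variable {a b h h' p q x : ℤ} {F : Set (Sym2 (ℤ × ℤ))} {w : Edge → ℝ}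

lemma rowEdges_subset_channelEdges {e : Edge} (he : e ∈ rowEdges a b h) :
    e.1 ∈ channelEdges a b := by
  obtain ⟨z, hz, rfl⟩ := Finset.mem_map.1 he
  rw [Finset.mem_Ico] at hz
  refine ⟨?_, (z, h), Sym2.mem_mk_left _ _, hz.2⟩
  simp only [Function.Embedding.coeFn_mk, rightEdge, Sym2.mem_iff]
  rintro u (rfl | rfl) <;> simp only [Prod.fst_add] <;> lia

lemma columnEdges_subset_channelEdges (ha : a ≤ x) (hb : x < b) {e : Edge}
    (he : e ∈ columnEdges x h h') : e.1 ∈ channelEdges a b := by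
  obtain ⟨z, -, rfl⟩ := Finset.mem_map.1 he
  refine ⟨?_, (x, z), Sym2.mem_mk_left _ _, hb⟩
  simp only [Function.Embedding.coeFn_mk, upEdge, Sym2.mem_iff]
  rintro u (rfl | rfl) <;> simp only [Prod.fst_add] <;> lia

lemma boxEdges_subset_channelEdges {L M : ℕ} (hM : 2 * M < b - a) :
    boxEdges L M (a + M, h) ⊆ channelEdges a b := fun e he => by
  have hu : ∀ u ∈ e, a ≤ u.1 ∧ u.1 ≤ a + 2 * M := fun u hu => by
    have := (he.1 u hu).1
    rw [abs_le] at this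
    lia
  obtain ⟨u, hue, -⟩ := he.2
  exact ⟨fun v hv => by have := hu v hv; lia, u, hue, by have := hu u hue; lia⟩

lemma restrictedTime_le_sum_rowEdges (hF : ∀ e ∈ rowEdges a b h, e.1 ∈ F)
    (hp : p ∈ Set.Icc a b) (hq : q ∈ Set.Icc a b) :
    restrictedTime F (p, h) (q, h) w ≤ ∑ e ∈ rowEdges a b h, ENNReal.ofReal (w e) := by
  wlog hpq : p ≤ q generalizing p q
  · rw [restrictedTime_symm]
    exact this hq hp (le_of_not_ge hpq)
  obtain ⟨m, rfl⟩ := Int.le.dest hpq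
  have hmem : ∀ i < m, p + (i : ℤ) ∈ Finset.Ico a b := fun i hi => by
    rw [Finset.mem_Ico]
    have := hp.1
    have := hq.2
    lia
  refine (restrictedTime_le_sum_rightEdge fun i hi => hF _ <|
    Finset.mem_map_of_mem _ (hmem i hi)).trans ?_
  rw [rowEdges, Finset.sum_map]
  refine (Finset.sum_image (g := fun i : ℕ => p + (i : ℤ))
    (f := fun z => ENNReal.ofReal (w (rightEdge (z, h)))) fun i _ j _ hij => ?_).symm.trans_le
    (Finset.sum_le_sum_of_subset (Finset.image_subset_iff.2 fun i hi =>
      hmem i (Finset.mem_range.1 hi)))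
  simpa using hij

lemma restrictedTime_le_sum_columnEdges (hF : ∀ e ∈ columnEdges x h h', e.1 ∈ F) (hh : h ≤ h') :
    restrictedTime F (x, h) (x, h') w ≤ ∑ e ∈ columnEdges x h h', ENNReal.ofReal (w e) := by
  obtain ⟨m, rfl⟩ := Int.le.dest hh
  have hmem : ∀ i < m, h + (i : ℤ) ∈ Finset.Ico h (h + m) := fun i hi => by
    rw [Finset.mem_Ico]
    lia
  refine (restrictedTime_le_sum_upEdge fun i hi => hF _ <|
    Finset.mem_map_of_mem _ (hmem i hi)).trans ?_
  rw [columnEdges, Finset.sum_map]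
  refine (Finset.sum_image (g := fun i : ℕ => h + (i : ℤ))
    (f := fun z => ENNReal.ofReal (w (upEdge (x, z)))) fun i _ j _ hij => ?_).symm.trans_le
    (Finset.sum_le_sum_of_subset (Finset.image_subset_iff.2 fun i hi =>
      hmem i (Finset.mem_range.1 hi)))
  simpa using hij

lemma restrictedTime_le_sum_boxTime {L M : ℕ} (hF : ∀ z, boxEdges L M (x, z) ⊆ F) (J : ℕ) :
    restrictedTime F (x, h) (x, h + (J * L : ℕ)) w
      ≤ ENNReal.ofReal (∑ j ∈ Finset.range J, boxTime L M (x, h + (j * L : ℕ)) w) := by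
  rw [ENNReal.ofReal_sum_of_nonneg fun _ _ => boxTime_nonneg]
  have hstep : ∀ j : ℕ, restrictedTime F (x, h + (j * L : ℕ)) (x, h + ((j + 1) * L : ℕ)) w
      ≤ ENNReal.ofReal (boxTime L M (x, h + (j * L : ℕ)) w) := fun j => by
    have htop : (x, h + ((j + 1) * L : ℕ)) = (x, h + (j * L : ℕ)) + (0, (L : ℤ)) := by
      ext
      · simp
      · simp only [Prod.snd_add]; push_cast; ring
    rw [boxTime, ENNReal.ofReal_toReal restrictedTime_boxEdges_ne_top, htop]
    exact restrictedTime_anti (hF _)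
  simpa using (restrictedTime_le_sum F w (fun j : ℕ => (x, h + (j * L : ℕ))) J).trans
    (Finset.sum_le_sum fun j _ => hstep j)

lemma card_connectorEdges_le (a b x h h₁ h' : ℤ) :
    (connectorEdges a b x h h₁ h').card ≤ 2 * (b - a).toNat + (h' - h₁).toNat := by
  have hrow : ∀ h, (rowEdges a b h).card = (b - a).toNat := fun h => by simp [rowEdges]
  have hcol : (columnEdges x h₁ h').card = (h' - h₁).toNat := by simp [columnEdges]
  have houter := Finset.card_union_le (rowEdges a b h ∪ columnEdges x h₁ h') (rowEdges a b h')
  have hinner := Finset.card_union_le (rowEdges a b h) (columnEdges x h₁ h')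
  rw [hrow] at houter hinner
  rw [hcol] at hinner
  rw [connectorEdges]
  lia

lemma channelTime_le_add_sum_connectorEdges {h₁ : ℤ} (ha : a ≤ x) (hb : x < b) (hh : h₁ ≤ h') :
    channelTime a b h h' w ≤ restrictedTime (channelEdges a b) (x, h) (x, h₁) w +
      3 * ∑ e ∈ connectorEdges a b x h h₁ h', ENNReal.ofReal (w e) := by
  set S := ∑ e ∈ connectorEdges a b x h h₁ h', ENNReal.ofReal (w e)
  have hx : x ∈ Set.Icc a b := ⟨ha, hb.le⟩
  refine iSup₂_le fun p hp => iSup₂_le fun q hq => ?_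
  have hbottom : restrictedTime (channelEdges a b) (p, h) (x, h) w ≤ S :=
    (restrictedTime_le_sum_rowEdges (fun _ => rowEdges_subset_channelEdges) hp hx).trans
      (Finset.sum_le_sum_of_subset (Finset.subset_union_left.trans Finset.subset_union_left))
  have hcolumn : restrictedTime (channelEdges a b) (x, h₁) (x, h') w ≤ S :=
    (restrictedTime_le_sum_columnEdges (fun _ => columnEdges_subset_channelEdges ha hb) hh).trans
      (Finset.sum_le_sum_of_subset (Finset.subset_union_right.trans Finset.subset_union_left))
  have htop : restrictedTime (channelEdges a b) (x, h') (q, h') w ≤ S :=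
    (restrictedTime_le_sum_rowEdges (fun _ => rowEdges_subset_channelEdges) hx hq).trans
      (Finset.sum_le_sum_of_subset Finset.subset_union_right)
  calc restrictedTime (channelEdges a b) (p, h) (q, h') w
      ≤ restrictedTime (channelEdges a b) (p, h) (x, h) w +
          (restrictedTime (channelEdges a b) (x, h) (x, h₁) w +
            (restrictedTime (channelEdges a b) (x, h₁) (x, h') w +
              restrictedTime (channelEdges a b) (x, h') (q, h') w)) := by
        refine (restrictedTime_triangle _ _ (x, h) _ w).trans ?_
        gcongr
        refine (restrictedTime_triangle _ _ (x, h₁) _ w).trans ?_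
        gcongr
        exact restrictedTime_triangle _ _ (x, h') _ w
    _ ≤ S + (restrictedTime (channelEdges a b) (x, h) (x, h₁) w + (S + S)) := by gcongr
    _ = restrictedTime (channelEdges a b) (x, h) (x, h₁) w + 3 * S := by ring

lemma channelTime_le (hw : ∀ e, 0 ≤ w e) {L M : ℕ} (hM : 2 * M < b - a) {J : ℕ}
    (hJ : h + (J * L : ℕ) ≤ h') :
    channelTime a b h h' w ≤ ENNReal.ofReal
      (∑ j ∈ Finset.range J, boxTime L M (a + M, h + (j * L : ℕ)) w +
        3 * ∑ e ∈ connectorEdges a b (a + M) h (h + (J * L : ℕ)) h', w e) := by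
  refine (channelTime_le_add_sum_connectorEdges (x := a + M) (by lia) (by lia) hJ).trans ?_
  rw [ENNReal.ofReal_add (Finset.sum_nonneg fun _ _ => boxTime_nonneg)
    (mul_nonneg (by norm_num) (Finset.sum_nonneg fun _ _ => hw _)),
    ENNReal.ofReal_mul (by norm_num), ENNReal.ofReal_sum_of_nonneg (f := w) fun _ _ => hw _,
    ENNReal.ofReal_ofNat]
  gcongr
  exact restrictedTime_le_sum_boxTime (fun z => boxEdges_subset_channelEdges hM) J

lemma restrictedTime_le_channelTime (hp : p ∈ Set.Icc a b) (hq : q ∈ Set.Icc a b) :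
    restrictedTime (channelEdges a b) (p, h) (q, h') w ≤ channelTime a b h h' w :=
  le_iSup₂_of_le p hp (le_iSup₂_of_le q hq le_rfl)

@[fun_prop]
lemma measurable_channelTime : Measurable (channelTime a b h h') :=
  .iSup fun _ => .iSup fun _ => .iSup fun _ => .iSup fun _ => by fun_prop

lemma dependsOn_channelTime :
    DependsOn (channelTime a b h h') {e : Edge | e.1 ∈ channelEdges a b} := fun w w' hw => by
  unfold channelTime
  simp only [dependsOn_restrictedTime hw]

lemma exists_walk_of_channelTime_lt {V : ℝ} (hV : channelTime a b h h' w < ENNReal.ofReal V)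
    (hp : p ∈ Set.Icc a b) (hq : q ∈ Set.Icc a b) :
    ∃ γ : latticeGraph.Walk (p, h) (q, h'),
      (∀ v ∈ γ.support, v.1 ∈ Set.Icc a b) ∧ passageTime w γ < V := by
  obtain ⟨γ, hγ, hlt⟩ := restrictedTime_lt_iff.1
    ((restrictedTime_le_channelTime hp hq).trans_lt hV)
  refine ⟨γ, fun v hv => ?_, (ENNReal.ofReal_lt_ofReal_iff'.1 hlt).1⟩
  rcases SimpleGraph.Walk.mem_support_iff_exists_mem_edges.1 hv with rfl | ⟨e, he, hve⟩
  · exact hq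
  · exact (hγ e he).1 v hve

end Channels

section ChannelBase

variable {δ : ℝ} {n l k : ℕ}

/-- The smallest element of `channelBase δ n l k`. -/
noncomputable def channelLeft (δ : ℝ) (n l k : ℕ) : ℤ := ⌈-(δ * n)⌉ + k * l

/-- The largest element of `channelBase δ n l k`. -/
noncomputable def channelRight (δ : ℝ) (n l k : ℕ) : ℤ := ⌊-(δ * n)⌋ + (k + 1) * l

lemma channelBase_eq_Icc :
    channelBase δ n l k = Set.Icc (channelLeft δ n l k) (channelRight δ n l k) := by
  ext z
  have hleft : channelLeft δ n l k ≤ z ↔ -(δ * n) + k * l ≤ (z : ℝ) := by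
    rw [channelLeft, ← le_sub_iff_add_le, Int.ceil_le, ← le_sub_iff_add_le]
    norm_cast
  have hright : z ≤ channelRight δ n l k ↔ (z : ℝ) ≤ -(δ * n) + (k + 1) * l := by
    rw [channelRight, ← sub_le_iff_le_add, Int.le_floor, ← sub_le_iff_le_add]
    norm_cast
  rw [Set.mem_Icc, hleft, hright]
  rfl

lemma channelRight_le_channelLeft {k' : ℕ} (hk : k < k') :
    channelRight δ n l k ≤ channelLeft δ n l k' := by
  have hmul : ((k : ℤ) + 1) * l ≤ k' * l := by gcongr; exact_mod_cast hk
  have := Int.floor_le_ceil (-(δ * n))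
  rw [channelLeft, channelRight]
  lia

lemma channelRight_sub_channelLeft_le :
    channelRight δ n l k - channelLeft δ n l k ≤ l := by
  have := Int.floor_le_ceil (-(δ * n))
  rw [channelLeft, channelRight]
  lia

lemma le_channelRight_sub_channelLeft :
    (l : ℤ) - 1 ≤ channelRight δ n l k - channelLeft δ n l k := by
  have := Int.ceil_le_floor_add_one (-(δ * n))
  rw [channelLeft, channelRight]
  lia

lemma pairwise_disjoint_channelEdges (δ : ℝ) (n l : ℕ) :
    Pairwise (Function.onFun Disjoint fun k : ℕ =>
      {e : Edge | e.1 ∈ channelEdges (channelLeft δ n l k) (channelRight δ n l k)}) := by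
  refine (pairwise_disjoint_on _).2 fun k k' hk => Set.disjoint_left.2 fun e he he' => ?_
  obtain ⟨u, hu, hlt⟩ := he.2
  have := (he'.1 u hu).1
  have := channelRight_le_channelLeft (δ := δ) (n := n) (l := l) hk
  lia

lemma goodChannel_of_channelTime_lt {w : Edge → ℝ} {ν ε : ℝ}
    (h : channelTime (channelLeft δ n l k) (channelRight δ n l k) ⌊δ * n⌋ ⌊(1 - δ) * n⌋ w
      < ENNReal.ofReal ((ν + ε / 5) * (1 - 2 * δ) * n)) : GoodChannel w ν ε δ n l k := by
  unfold GoodChannel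
  rw [channelBase_eq_Icc]
  intro p hp q hq
  obtain ⟨γ, hγ, hlt⟩ := exists_walk_of_channelTime_lt h hp hq
  exact ⟨γ, hγ, hlt.le⟩

end ChannelBase

lemma pairwise_disjoint_boxEdges (L M : ℕ) (x h : ℤ) :
    Pairwise (Function.onFun Disjoint fun j : ℕ =>
      {e : Edge | e.1 ∈ boxEdges L M (x, h + (j * L : ℕ))}) := by
  refine (pairwise_disjoint_on _).2 fun j j' hj => Set.disjoint_left.2 fun e he he' => ?_
  obtain ⟨u, hu, hlt⟩ := he'.2
  have htop := (he.1 u hu).2.2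
  have : (j + 1) * L ≤ j' * L := Nat.mul_le_mul_right L hj
  dsimp only at hlt htop
  lia

namespace IIDWeights

variable {Ω : Type*} [MeasurableSpace Ω] {P : Measure Ω} {t : Edge → Ω → ℝ} {θ τ : ℝ}

lemma measureReal_le_sum_boxTime_le (ht : IIDWeights P t) {L M : ℕ} (hθ : 0 ≤ θ)
    (hint : ∀ e, θ ∈ integrableExpSet (t e) P)
    (hmgf : ∀ v, mgf (fun ω => boxTime L M v (t · ω)) P θ ≤ Real.exp (θ * (τ * L)))
    (x h : ℤ) (J : ℕ) (r : ℝ) :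
    P.real {ω | r ≤ ∑ j ∈ Finset.range J, boxTime L M (x, h + (j * L : ℕ)) (t · ω)}
      ≤ Real.exp (θ * (τ * (J * L : ℕ) - r)) := by
  have := ht.indep.isProbabilityMeasure
  let X : ℕ → Ω → ℝ := fun j ω => boxTime L M (x, h + (j * L : ℕ)) (t · ω)
  have hX : ∀ j, Measurable (X j) := fun j => measurable_boxTime.comp ht.measurable_pi
  have hX_indep : iIndepFun X P := iIndepFun_comp_of_dependsOn ht.measurable ht.indep
    (fun _ => measurable_boxTime) (fun _ => dependsOn_boxTime) (pairwise_disjoint_boxEdges L M x h)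
  have hsum : ∀ ω, ∑ j ∈ Finset.range J, boxTime L M (x, h + (j * L : ℕ)) (t · ω)
      = (∑ j ∈ Finset.range J, X j) ω := fun ω => by rw [Finset.sum_apply]
  simp only [hsum]
  calc P.real {ω | r ≤ (∑ j ∈ Finset.range J, X j) ω}
      ≤ Real.exp (-θ * r) * mgf (∑ j ∈ Finset.range J, X j) P θ :=
        measure_ge_le_exp_mul_mgf r hθ (hX_indep.integrable_exp_mul_sum hX
          fun j _ => ht.mem_integrableExpSet_boxTime hθ hint _)
    _ ≤ Real.exp (-θ * r) * Real.exp (θ * (τ * L)) ^ J := by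
        rw [hX_indep.mgf_sum hX]
        gcongr
        exact (Finset.prod_le_prod (fun _ _ => mgf_nonneg) fun j _ => hmgf _).trans_eq (by simp)
    _ = Real.exp (θ * (τ * (J * L : ℕ) - r)) := by
        rw [← Real.exp_nat_mul, ← Real.exp_add]
        push_cast
        ring_nf

lemma measureReal_le_three_mul_sum_le (ht : IIDWeights P t) (hθ : 0 ≤ θ)
    (hint : ∀ e, 3 * θ ∈ integrableExpSet (t e) P) (R : Finset Edge) (r : ℝ) (e₀ : Edge) :
    P.real {ω | r ≤ 3 * ∑ e ∈ R, t e ω}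
      ≤ mgf (t e₀) P (3 * θ) ^ R.card * Real.exp (-(θ * r)) := by
  have := ht.indep.isProbabilityMeasure
  have hset : {ω | r ≤ 3 * ∑ e ∈ R, t e ω} = {ω | r / 3 ≤ (∑ e ∈ R, t e) ω} := by
    ext ω
    simp only [Set.mem_ofPred_eq, Finset.sum_apply]
    rw [div_le_iff₀' three_pos]
  rw [hset]
  refine (measure_ge_le_exp_mul_mgf _ (by positivity)
    (ht.indep.integrable_exp_mul_sum ht.measurable fun e _ => hint e)).trans_eq ?_
  rw [ht.indep.mgf_sum ht.measurable,
    Finset.prod_congr rfl fun e _ => congrFun (mgf_congr_identDistrib (ht.ident e e₀)) _,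
    Finset.prod_const, mul_comm]
  ring_nf

lemma one_le_mgf (ht : IIDWeights P t) (hθ : 0 ≤ θ) {e : Edge}
    (hint : θ ∈ integrableExpSet (t e) P) : 1 ≤ mgf (t e) P θ := by
  have := ht.indep.isProbabilityMeasure
  simpa using mgf_mono_of_nonneg (X := 0) (.of_forall (ht.nonneg e)) hθ hint

lemma measureReal_add_le_channelTime_le (ht : IIDWeights P t) {a b h h' : ℤ} {L M J : ℕ}
    (hM : 2 * M < b - a) (hJ : h + (J * L : ℕ) ≤ h') (r s : ℝ) :
    P.real {ω | ENNReal.ofReal (r + s) ≤ channelTime a b h h' (t · ω)}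
      ≤ P.real {ω | r ≤ ∑ j ∈ Finset.range J, boxTime L M (a + M, h + (j * L : ℕ)) (t · ω)} +
        P.real {ω | s ≤ 3 * ∑ e ∈ connectorEdges a b (a + M) h (h + (J * L : ℕ)) h', t e ω} := by
  have := ht.indep.isProbabilityMeasure
  refine (measureReal_mono fun ω hω => ?_).trans (measureReal_union_le _ _)
  have hle := (ENNReal.ofReal_le_ofReal_iff (add_nonneg
    (Finset.sum_nonneg fun _ _ => boxTime_nonneg) (mul_nonneg (by norm_num)
      (Finset.sum_nonneg fun _ _ => ht.nonneg _ _)))).1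
    (hω.trans (channelTime_le (ht.nonneg · ω) hM hJ))
  by_contra hnot
  simp only [Set.mem_union, Set.mem_ofPred_eq, not_or, not_le] at hnot
  linarith

/- The tower of boxes in column `a + M` takes time at most about `τ * (h' - h)`, and its connection
to the entry and exit points uses a bounded number of edges. -/
lemma exists_measureReal_le_channelTime_le (ht : IIDWeights P t) (hτ : timeConstant P t < τ) :
    ∃ M : ℕ, ∃ θ : ℝ, 0 < θ ∧ ∀ l : ℕ, ∃ C : ℝ, ∀ a b h h' : ℤ, 2 * M < b - a → b - a ≤ l →
      h ≤ h' → ∀ s : ℝ,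
        P.real {ω | ENNReal.ofReal (τ * (h' - h : ℤ) + 2 * s) ≤ channelTime a b h h' (t · ω)}
          ≤ Real.exp (C - θ * s) := by
  obtain ⟨L, M, hL, θ, hθ, hint, hmgf⟩ := ht.exists_mgf_boxTime_le hτ
  have hint' : ∀ e, θ ∈ integrableExpSet (t e) P := fun e =>
    Iic_subset_integrableExpSet (ht.nonneg e) (ht.measurable e) (hint e)
      (Set.mem_Iic.2 (by linarith))
  let e₀ := rightEdge (0, 0)
  let m := mgf (t e₀) P (3 * θ)
  have hm : 1 ≤ m := ht.one_le_mgf (by positivity) (hint e₀)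
  refine ⟨M, θ, hθ, fun l => ⟨Real.log (1 + m ^ (2 * l + L)), fun a b h h' hM hl hh s => ?_⟩⟩
  obtain ⟨H, rfl⟩ := Int.le.dest hh
  have hdiv := Nat.div_add_mod' H L
  have hmod := Nat.mod_lt H hL
  let J := H / L
  have hJ : h + (J * L : ℕ) ≤ h + H := by lia
  have hcard : (connectorEdges a b (a + M) h (h + (J * L : ℕ)) (h + H)).card ≤ 2 * l + L :=
    (card_connectorEdges_le _ _ _ _ _ _).trans (by lia)
  have htower := ht.measureReal_le_sum_boxTime_le hθ.le hint' hmgf (a + M) h J (τ * H + s)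
  have hconnectors := ht.measureReal_le_three_mul_sum_le hθ.le hint
    (connectorEdges a b (a + M) h (h + (J * L : ℕ)) (h + H)) s e₀
  calc P.real {ω | ENNReal.ofReal (τ * (h + H - h : ℤ) + 2 * s) ≤
          channelTime a b h (h + H) (t · ω)}
      = P.real {ω | ENNReal.ofReal (τ * H + s + s) ≤ channelTime a b h (h + H) (t · ω)} := by
        rw [add_sub_cancel_left, Int.cast_natCast, two_mul, add_assoc]
    _ ≤ Real.exp (θ * (τ * (J * L : ℕ) - (τ * H + s))) + m ^ _ * Real.exp (-(θ * s)) :=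
        (ht.measureReal_add_le_channelTime_le hM hJ _ _).trans (add_le_add htower hconnectors)
    _ ≤ Real.exp (-(θ * s)) + m ^ (2 * l + L) * Real.exp (-(θ * s)) := by
        have hJH : τ * (J * L : ℕ) ≤ τ * H := mul_le_mul_of_nonneg_left
          (by exact_mod_cast (by lia)) (ht.timeConstant_nonneg.trans hτ.le)
        gcongr
        rw [← mul_neg]
        exact mul_le_mul_of_nonneg_left (by linarith) hθ.le
    _ = Real.exp (Real.log (1 + m ^ (2 * l + L)) - θ * s) := by
        rw [sub_eq_add_neg, Real.exp_add, Real.exp_log (by positivity)]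
        ring

end IIDWeights

open Classical in
lemma le_card_not_goodChannel {w : Edge → ℝ} {ν ε δ : ℝ} {n l : ℕ} (hδ : 0 ≤ δ)
    (h : ¬ MostChannelsGood w ν ε δ n l) :
    1 / 10 * (2 * δ * n / l) ≤ ((Finset.range (⌊2 * δ * n / l⌋₊ + 1)).filter
      fun k => ¬ GoodChannel w ν ε δ n l k).card := by
  set x := 2 * δ * n / l
  have hx : 0 ≤ x := by positivity
  set good := (Finset.range (⌊x⌋₊ + 1)).filter fun k => GoodChannel w ν ε δ n l k with hgood
  have hset : {k : ℕ | (k : ℝ) ≤ x ∧ GoodChannel w ν ε δ n l k} = good := by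
    ext k
    simp [hgood, Nat.le_floor_iff hx]
  have hfew : (good.card : ℝ) < 9 / 10 * x := by
    rw [MostChannelsGood, hset, Set.ncard_coe_finset, not_le] at h
    exact h
  have hcard := Finset.card_filter_add_card_filter_not
    (s := Finset.range (⌊x⌋₊ + 1)) fun k => GoodChannel w ν ε δ n l k
  rw [Finset.card_range] at hcard
  have hfloor := Nat.lt_floor_add_one x
  have : (good.card : ℝ) + ((Finset.range (⌊x⌋₊ + 1)).filter
      fun k => ¬ GoodChannel w ν ε δ n l k).card = ⌊x⌋₊ + 1 := by exact_mod_cast hcard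
  linarith

lemma exists_eventually_le_neg_sq {α d : ℝ} (hα : 0 < α) (hd : 0 < d) (β : ℝ) :
    ∃ c : ℝ, 0 < c ∧ ∀ᶠ n : ℕ in atTop,
      d * n + 1 - (α * n - β) * (1 / 10 * (d * n)) ≤ -(c * (n : ℝ) ^ 2) := by
  have hc : 0 < α * d / 20 := by positivity
  refine ⟨α * d / 20, hc, ?_⟩
  have hlarge := tendsto_natCast_atTop_atTop.const_mul_atTop hc |>.eventually_ge_atTop
    (d + β * d / 10 + 1)
  filter_upwards [hlarge, eventually_ge_atTop 1] with n hn hn1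
  have : (1 : ℝ) ≤ n := by exact_mod_cast hn1
  nlinarith [mul_le_mul_of_nonneg_right hn n.cast_nonneg]

namespace IIDWeights

variable {Ω : Type*} [MeasurableSpace Ω] {P : Measure Ω} {t : Edge → Ω → ℝ}

lemma iIndepSet_le_channelTime (ht : IIDWeights P t) (δ : ℝ) (n l : ℕ) (h h' : ℤ) (V : ℝ≥0∞) :
    iIndepSet (fun k => {ω | V ≤ channelTime (channelLeft δ n l k) (channelRight δ n l k) h h'
      (t · ω)}) P := by
  have hindep := iIndepFun_comp_of_dependsOn ht.measurable ht.indep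
    (fun k => measurable_channelTime (h := h) (h' := h')) (fun _ => dependsOn_channelTime)
    (pairwise_disjoint_channelEdges δ n l)
  exact (iIndepSet_iff_meas_biInter fun k => measurableSet_le measurable_const
    (measurable_channelTime.comp ht.measurable_pi)).2 fun A =>
      hindep.measure_inter_preimage_eq_mul A fun _ _ => measurableSet_Ici

lemma exists_measureReal_le_channelTime_le_exp_neg (ht : IIDWeights P t) {ε : ℝ} (hε : 0 < ε) :
    ∃ l₀ : ℕ, 0 < l₀ ∧ ∀ l : ℕ, l₀ ≤ l → ∀ δ : ℝ, δ < 1 / 2 →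
      ∃ α : ℝ, 0 < α ∧ ∃ β : ℝ, ∀ n k : ℕ,
        P.real {ω | ENNReal.ofReal ((timeConstant P t + ε / 5) * (1 - 2 * δ) * n) ≤
          channelTime (channelLeft δ n l k) (channelRight δ n l k) ⌊δ * n⌋ ⌊(1 - δ) * n⌋
            (t · ω)} ≤ Real.exp (-(α * n - β)) := by
  set ν := timeConstant P t
  set τ := ν + ε / 10
  have hτ : 0 ≤ τ := add_nonneg ht.timeConstant_nonneg (by positivity)
  have hντ : ν < τ := lt_add_of_pos_right ν (by positivity)
  obtain ⟨M, θ, hθ, hbound⟩ := ht.exists_measureReal_le_channelTime_le hντ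
  refine ⟨2 * M + 2, by positivity, fun l hl δ hδ => ?_⟩
  obtain ⟨C, hC⟩ := hbound l
  have hκ : 0 < 1 - 2 * δ := by linarith
  refine ⟨θ * ε * (1 - 2 * δ) / 20, by positivity, C + θ * τ / 2, fun n k => ?_⟩
  set V := (ν + ε / 5) * (1 - 2 * δ) * n
  set H : ℤ := ⌊(1 - δ) * n⌋ - ⌊δ * n⌋ with hH
  have hwidth := le_channelRight_sub_channelLeft (δ := δ) (n := n) (l := l) (k := k)
  have hheight : ⌊δ * n⌋ ≤ ⌊(1 - δ) * n⌋ := Int.floor_le_floor (by gcongr; linarith)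
  have hlen : (H : ℝ) ≤ (1 - 2 * δ) * n + 1 := by
    have := Int.floor_le ((1 - δ) * n)
    have := Int.lt_floor_add_one (δ * n)
    rw [hH]
    push_cast
    linarith
  have hprob := hC (channelLeft δ n l k) (channelRight δ n l k) ⌊δ * n⌋ ⌊(1 - δ) * n⌋ (by lia)
    channelRight_sub_channelLeft_le hheight ((V - τ * H) / 2)
  rw [mul_div_cancel₀ _ two_ne_zero, ← hH, add_sub_cancel] at hprob
  refine hprob.trans (Real.exp_le_exp.2 ?_)
  have hslack : ε / 10 * (1 - 2 * δ) * n - τ ≤ V - τ * H := by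
    have hsplit : V = τ * ((1 - 2 * δ) * n) + ε / 10 * (1 - 2 * δ) * n := by ring
    linarith [mul_le_mul_of_nonneg_left hlen hτ]
  linarith [mul_le_mul_of_nonneg_left hslack hθ.le]

lemma measureReal_not_mostChannelsGood_le (ht : IIDWeights P t) {ν ε δ ρ : ℝ} {n l : ℕ}
    (hδ : 0 ≤ δ) (hρ : 0 ≤ ρ)
    (hbad : ∀ k, P.real {ω | ENNReal.ofReal ((ν + ε / 5) * (1 - 2 * δ) * n) ≤
      channelTime (channelLeft δ n l k) (channelRight δ n l k) ⌊δ * n⌋ ⌊(1 - δ) * n⌋ (t · ω)}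
        ≤ Real.exp (-ρ)) :
    P.real {ω | ¬ MostChannelsGood (t · ω) ν ε δ n l}
      ≤ Real.exp (2 * δ * n / l + 1 - ρ * (1 / 10 * (2 * δ * n / l))) := by
  classical
  have := ht.indep.isProbabilityMeasure
  set x := 2 * δ * n / l
  let A : ℕ → Set Ω := fun k => {ω | ENNReal.ofReal ((ν + ε / 5) * (1 - 2 * δ) * n) ≤
    channelTime (channelLeft δ n l k) (channelRight δ n l k) ⌊δ * n⌋ ⌊(1 - δ) * n⌋ (t · ω)}
  have hA : ∀ k, MeasurableSet (A k) := fun k =>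
    measurableSet_le measurable_const (measurable_channelTime.comp ht.measurable_pi)
  have hsub : {ω | ¬ MostChannelsGood (t · ω) ν ε δ n l} ⊆
      {ω | 1 / 10 * x ≤ ((Finset.range (⌊x⌋₊ + 1)).filter fun k => ω ∈ A k).card} := fun ω hω => by
    refine (le_card_not_goodChannel hδ hω).trans ?_
    gcongr with k
    exact fun hbad => not_lt.1 fun hlt => hbad (goodChannel_of_channelTime_lt hlt)
  have htwo : (2 : ℝ) ^ (⌊x⌋₊ + 1) ≤ Real.exp (x + 1) := by
    have hfloor := Nat.floor_le (show 0 ≤ x by positivity)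
    calc (2 : ℝ) ^ (⌊x⌋₊ + 1) ≤ Real.exp 1 ^ (⌊x⌋₊ + 1) := by
          gcongr
          linarith [Real.add_one_le_exp 1]
      _ = Real.exp (⌊x⌋₊ + 1) := by rw [Real.exp_one_pow]; push_cast; rfl
      _ ≤ Real.exp (x + 1) := by gcongr
  calc P.real {ω | ¬ MostChannelsGood (t · ω) ν ε δ n l}
      ≤ 2 ^ (⌊x⌋₊ + 1) * Real.exp (-(ρ * (1 / 10 * x))) := by
        have hcount := measureReal_le_card_filter_le hA (ht.iIndepSet_le_channelTime _ _ _ _ _ _)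
          hρ hbad (Finset.range (⌊x⌋₊ + 1)) (1 / 10 * x)
        rw [Finset.card_range] at hcount
        exact (measureReal_mono hsub).trans hcount
    _ ≤ Real.exp (x + 1) * Real.exp (-(ρ * (1 / 10 * x))) := by gcongr
    _ = Real.exp (x + 1 - ρ * (1 / 10 * x)) := by rw [← Real.exp_add, ← sub_eq_add_neg]

lemma exists_le_measureReal_mostChannelsGood (ht : IIDWeights P t) {ε : ℝ} (hε : 0 < ε) :
    ∃ l₀ : ℕ, 0 < l₀ ∧ ∀ l : ℕ, l₀ ≤ l → ∀ δ : ℝ, 0 < δ → δ < 1 / 2 →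
      ∃ c : ℝ, 0 < c ∧ ∃ n₀ : ℕ, ∀ n : ℕ, n₀ ≤ n →
        1 - Real.exp (-(c * (n : ℝ) ^ 2)) ≤
          P.real {ω | MostChannelsGood (t · ω) (timeConstant P t) ε δ n l} := by
  have := ht.indep.isProbabilityMeasure
  obtain ⟨l₀, hl₀, hchannel⟩ := ht.exists_measureReal_le_channelTime_le_exp_neg hε
  refine ⟨l₀, hl₀, fun l hl δ hδ hδ' => ?_⟩
  obtain ⟨α, hα, β, hbad⟩ := hchannel l hl δ hδ'
  have hl_pos : (0 : ℝ) < l := by exact_mod_cast hl₀.trans_le hl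
  obtain ⟨c, hc, hquad⟩ := exists_eventually_le_neg_sq hα (by positivity : 0 < 2 * δ / l) β
  have hρ := (tendsto_natCast_atTop_atTop.const_mul_atTop hα).eventually_ge_atTop β
  refine ⟨c, hc, eventually_atTop.1 ?_⟩
  filter_upwards [hquad, hρ] with n hn hρ
  set G := {ω | MostChannelsGood (t · ω) (timeConstant P t) ε δ n l}
  have hcompl : P.real Gᶜ ≤ Real.exp (-(c * (n : ℝ) ^ 2)) := by
    refine (ht.measureReal_not_mostChannelsGood_le hδ.le (sub_nonneg.2 hρ) (hbad n)).trans
      (Real.exp_le_exp.2 ?_)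
    rwa [mul_div_right_comm]
  have htotal := measureReal_union_le (μ := P) G Gᶜ
  rw [Set.union_compl_self, probReal_univ] at htotal
  linarith

end IIDWeights

lemma iidWeights_posPart {Ω : Type*} [MeasurableSpace Ω] {P : Measure Ω} {t : Edge → Ω → ℝ}
    (hmeas : ∀ e, Measurable (t e)) (hindep : iIndepFun t P)
    (hident : ∀ e e', IdentDistrib (t e) (t e') P P) (hnonneg : ∀ e, ∀ᵐ ω ∂P, 0 ≤ t e ω)
    (hexp : ∃ c₀ : ℝ, 0 < c₀ ∧ ∀ e, Integrable (fun ω => Real.exp (c₀ * t e ω)) P) :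
    IIDWeights P fun e ω => max (t e ω) 0 where
  measurable e := (hmeas e).max measurable_const
  indep := hindep.comp (fun _ x => max x 0) fun _ => by fun_prop
  ident e e' := (hident e e').comp (u := fun x => max x 0) (by fun_prop)
  nonneg _ _ := le_max_right _ _
  exp_moment := by
    obtain ⟨c, hc, h⟩ := hexp
    exact ⟨c, hc, fun e => (h e).congr ((hnonneg e).mono fun ω hω => by simp only [max_eq_left hω])⟩

end FPP

theorem proposition2p2_general {Ω : Type*} [MeasurableSpace Ω] (P : Measure Ω)
    (t : FPP.Edge → Ω → ℝ)
    (hmeas : ∀ e, Measurable (t e))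
    (hindep : iIndepFun t P)
    (hident : ∀ e e', IdentDistrib (t e) (t e') P P)
    (hnonneg : ∀ e, ∀ᵐ ω ∂P, 0 ≤ t e ω)
    (hexp : ∃ c₀ : ℝ, 0 < c₀ ∧ ∀ e, Integrable (fun ω => Real.exp (c₀ * t e ω)) P) :
    ∀ ε : ℝ, 0 < ε → ∃ l₀ : ℕ, 0 < l₀ ∧ ∀ l : ℕ, l₀ ≤ l → ∀ δ : ℝ, 0 < δ → δ < 1 / 2 →
      ∃ c : ℝ, 0 < c ∧ ∃ n₀ : ℕ, ∀ n : ℕ, n₀ ≤ n →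
        1 - Real.exp (-(c * (n : ℝ) ^ 2)) ≤
          P.real {ω | FPP.MostChannelsGood (fun e => t e ω) (FPP.timeConstant P t) ε δ n l} := by
  intro ε hε
  have hs := FPP.iidWeights_posPart hmeas hindep hident hnonneg hexp
  have hae : ∀ᵐ ω ∂P, (fun e => max (t e ω) 0) = (t · ω) :=
    (ae_all_iff.2 hnonneg).mono fun ω hω => funext fun e => max_eq_left (hω e)
  have hν : FPP.timeConstant P (fun e ω => max (t e ω) 0) = FPP.timeConstant P t :=
    essSup_congr_ae (hae.mono fun ω hω => by simp only [hω])
  have hprob : ∀ δ n l, P.real {ω | FPP.MostChannelsGood (fun e => max (t e ω) 0)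
      (FPP.timeConstant P t) ε δ n l} =
        P.real {ω | FPP.MostChannelsGood (fun e => t e ω) (FPP.timeConstant P t) ε δ n l} :=
    fun δ n l => measureReal_congr (hae.mono fun ω hω =>
      congrArg (FPP.MostChannelsGood · (FPP.timeConstant P t) ε δ n l) hω)
  simpa only [hν, hprob] using hs.exists_le_measureReal_mostChannelsGood hε

theorem proposition2p2 {Ω : Type*} [MeasurableSpace Ω] (P : Measure Ω) [IsProbabilityMeasure P]
    (t : FPP.Edge → Ω → ℝ)
    (hmeas : ∀ e, Measurable (t e))
    (hindep : iIndepFun t P)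
    (hident : ∀ e e', IdentDistrib (t e) (t e') P P)
    (hnonneg : ∀ e, ∀ᵐ ω ∂P, 0 ≤ t e ω)
    (hexp : ∃ c₀ : ℝ, 0 < c₀ ∧ ∀ e, Integrable (fun ω => Real.exp (c₀ * t e ω)) P) :
    ∃ ε₀ : ℝ, 0 < ε₀ ∧ ∃ δ₀ : ℝ, 0 < δ₀ ∧
      ∀ ε : ℝ, 0 < ε → ε < ε₀ →
        ∃ l₀ : ℕ, 0 < l₀ ∧ ∀ l : ℕ, l₀ ≤ l →
          ∀ δ : ℝ, 0 < δ → δ < δ₀ →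
            ∃ c : ℝ, 0 < c ∧ ∃ n₀ : ℕ, ∀ n : ℕ, n₀ ≤ n →
              1 - Real.exp (-(c * (n : ℝ) ^ 2)) ≤
                P.real {ω | FPP.MostChannelsGood (fun e => t e ω)
                  (FPP.timeConstant P t) ε δ n l} :=
  ⟨1, one_pos, 1 / 2, one_half_pos, fun ε hε _ =>
    proposition2p2_general P t hmeas hindep hident hnonneg hexp ε hε⟩
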